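/- Let $X$ be a complete CAT(0) space with base point $x_0$, let $\partial X$ be its visual boundary (asymptote classes of geodesic rays) and $\overline X=X\cup\partial X$ with the cone topology. For $p\in X$ and $\xi,\eta\in\overline X\setminus\{p\}$ let $\angle_p(\xi,\eta)$ be the Alexandrov angle at $p$ between the geodesic segments or rays from $p$ to $\xi$ and to $\eta$, and let $\angle(\xi,\eta)=\sup_{p}\angle_p(\xi,\eta)$, the supremum being over all $p\in X\setminus\{\xi,\eta\}$. On $\partial X$ this is the angular metric; if $\eta\in X$ and $\xi\in\partial X$, then $\angle(\eta,\xi)=\pi$. For $\xi\in\partial X$ the star of $\xi$ is $$S(\xi)=\overline{\bigcup_{C\ge 0}\ \bigcap_{V}\ \overline{H(V,C)}},\qquad H(V,C)=\{z\in X: d(z,V\cap X)\le d(z,x_0)+C\},$$ where $V$ runs over the open neighbourhoods of $\xi$ in $\overline X$ and closures are taken in $\overline X$. Let $(g_n)$ be a sequence of isometries of $X$ (distance-preserving bijections, acting also on $\overline X$) such that $g_nx_0\to\xi^+\in\partial X$ and $g_n^{-1}x_0\to\xi^-\in\partial X$. Put $B=\{\zeta\in\partial X:\angle(\xi^+,\zeta)\le\pi/2\}$.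 1. For every $\eta\in\overline X$ with $\angle(\eta,\xi^-)>\pi/2$ and every $p\in X$, $$\limsup_{n\to\infty}\angle_p(\xi^+,g_n\eta)\le\pi/2 .$$ 2. If $X$ is proper, then for every $\eta\in\overline X$ with $\angle(\eta,\xi^-)>\pi/2$ one has $g_n\eta\to B$: for every open set $U\supseteq B$ of $\overline X$, $g_n\eta\in U$ for all sufficiently large $n$. 3. If $X$ is proper, the convergence is uniform outside neighbourhoods of $S(\xi^-)$: for all open sets $W\supseteq S(\xi^-)$ and $U\supseteq B$ of $\overline X$ there is $N$ such that $g_n(\overline X\setminus W)\subseteq U$ for all $n\ge N$. -/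

import Mathlib

open Filter Topology Set
open scoped NNReal

namespace CatZero

universe u

/-- A CAT(0) space: any two points are joined by a geodesic segment, and geodesic triangles are at
least as thin as their Euclidean comparison triangles. In a geodesic space a point `x` lies on some
geodesic segment from `p` to `q` exactly when `dist p x + dist x q = dist p q`; so `x` and `y` below
are arbitrary points on the sides `[p, q]` and `[p, r]` of an arbitrary geodesic triangle, and
`x'`, `y'` are their comparison points in a comparison triangle `p'`, `q'`, `r'` in the plane. -/
structure IsCAT0 (X : Type u) [MetricSpace X] : Prop where
  geodesic : ∀ x y : X, ∃ γ : ℝ → X, γ 0 = x ∧ γ (dist x y) = y ∧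
    ∀ s ∈ Icc 0 (dist x y), ∀ t ∈ Icc 0 (dist x y), dist (γ s) (γ t) = |s - t|
  comparison : ∀ p q r x y : X,
    dist p x + dist x q = dist p q → dist p y + dist y r = dist p r →
    ∀ p' q' r' x' y' : EuclideanSpace ℝ (Fin 2),
      dist p' q' = dist p q → dist p' r' = dist p r → dist q' r' = dist q r →
      dist p' x' = dist p x → dist x' q' = dist x q →
      dist p' y' = dist p y → dist y' r' = dist y r →
      dist x y ≤ dist x' y'

/-- Unit speed geodesic rays `[0, ∞) → X`. -/
def GeodesicRay (X : Type u) [MetricSpace X] : Type u := {c : ℝ≥0 → X // Isometry c}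

/-- Two rays are asymptotic if they stay at bounded distance from each other. -/
def GeodesicRay.setoid (X : Type u) [MetricSpace X] : Setoid (GeodesicRay X) where
  r c c' := ∃ K : ℝ, ∀ t : ℝ≥0, dist (c.1 t) (c'.1 t) ≤ K
  iseqv :=
    { refl := fun c => ⟨0, fun t => by simp⟩
      symm := fun ⟨K, h⟩ => ⟨K, fun t => by rw [dist_comm]; exact h t⟩
      trans := fun ⟨K, h⟩ ⟨L, h'⟩ =>
        ⟨K + L, fun t => (dist_triangle _ _ _).trans (add_le_add (h t) (h' t))⟩ }

/-- The visual boundary `∂X`: asymptote classes of geodesic rays. -/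
def Boundary (X : Type u) [MetricSpace X] : Type u := Quotient (GeodesicRay.setoid X)

/-- The boundary point represented by a ray. -/
def GeodesicRay.endpoint {X : Type u} [MetricSpace X] (c : GeodesicRay X) : Boundary X :=
  Quotient.mk (GeodesicRay.setoid X) c

/-- The visual bordification `X ∪ ∂X`, as a set. -/
inductive Bordification (X : Type u) [MetricSpace X] : Type u
  | inside (x : X) : Bordification X
  | atInfinity (ξ : Boundary X) : Bordification X

variable {X : Type u} [MetricSpace X]

/-- `trace p η r` is the point at distance `r` from `p` on the geodesic segment or ray from `p` to
`η`, where the segment from `p` to a point of `X` is prolonged by staying at its end. In a complete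
CAT(0) space this segment or ray exists and is unique, and `η ↦ trace p η r` is the projection of
the bordification onto the closed ball of radius `r` around `p`. -/
noncomputable def trace (p : X) : Bordification X → ℝ≥0 → X
  | .inside x, r => @Classical.epsilon X ⟨p⟩ fun y =>
      dist p y = min (r : ℝ) (dist p x) ∧ dist p y + dist y x = dist p x
  | .atInfinity ξ, r => @Classical.epsilon X ⟨p⟩ fun y =>
      ∃ c : GeodesicRay X, c.1 0 = p ∧ c.endpoint = ξ ∧ c.1 r = y

/-- The cone topology on `X ∪ ∂X` with base point `x₀`: the bordification is the inverse limit of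
the closed balls around `x₀` under the projections, so its topology is the coarsest one for which
every projection `η ↦ trace x₀ η r` is continuous. (For a complete CAT(0) space it does not depend
on `x₀`.) -/
@[reducible]
noncomputable def coneTopology (x₀ : X) : TopologicalSpace (Bordification X) :=
  TopologicalSpace.induced (trace x₀) Pi.topologicalSpace

/-- The action of an isometry on geodesic rays. -/
def GeodesicRay.map (g : X ≃ᵢ X) (c : GeodesicRay X) : GeodesicRay X :=
  ⟨fun t => g (c.1 t), g.isometry.comp c.2⟩

/-- The action of an isometry on the visual boundary. -/
def Boundary.map (g : X ≃ᵢ X) : Boundary X → Boundary X :=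
  Quotient.map (GeodesicRay.map g) fun _ _ ⟨K, h⟩ =>
    ⟨K, fun t => (g.dist_eq _ _).trans_le (h t)⟩

/-- The action of an isometry on the bordification. -/
def Bordification.map (g : X ≃ᵢ X) : Bordification X → Bordification X
  | .inside x => .inside (g x)
  | .atInfinity ξ => .atInfinity (ξ.map g)

/-- The Euclidean comparison angle at `p`, given by the law of cosines. -/
noncomputable def comparisonAngle (p x y : X) : ℝ :=
  Real.arccos ((dist p x ^ 2 + dist p y ^ 2 - dist x y ^ 2) / (2 * dist p x * dist p y))

/-- The Alexandrov angle `∠_p(ξ, η)` at `p ∈ X` between the geodesic segments or rays from `p` to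
`ξ, η ∈ X ∪ ∂X` (both different from `p`): the upper limit, as `s, t → 0`, of the comparison angles
of the points at distance `s` and `t` from `p`. -/
noncomputable def angleAt (p : X) (ξ η : Bordification X) : ℝ :=
  limsup (fun st : ℝ≥0 × ℝ≥0 => comparisonAngle p (trace p ξ st.1) (trace p η st.2))
    (𝓝[>] 0 ×ˢ 𝓝[>] 0)

/-- The angle `∠(ξ, η) = sup_p ∠_p(ξ, η)`. On the boundary this is the angular metric, the
supremum being over all of `X`. If one of the two points lies in `X`, it is left out
of the supremum (no angle at it is defined). -/
noncomputable def angle (ξ η : Bordification X) : ℝ :=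
  ⨆ p : {p : X // .inside p ≠ ξ ∧ .inside p ≠ η}, angleAt p.1 ξ η

/-- The halfspace `H(W, C) = {z ∈ X : d(z, W) ≤ d(z, x₀) + C}` of a subset `W` of the
bordification. Points at infinity have infinite distance to `z`, so only `W ∩ X` matters, and
`d(z, W) = ∞` if `W ∩ X` is empty. -/
def halfspace (x₀ : X) (W : Set (Bordification X)) (C : ℝ) : Set X :=
  {z | {w : X | .inside w ∈ W}.Nonempty ∧
    Metric.infDist z {w : X | .inside w ∈ W} ≤ dist z x₀ + C}

/-- The star `S(ξ)` of a boundary point: the closure of the union over `C ≥ 0` of the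
intersections, over the open neighbourhoods `V` of `ξ`, of the closures of `H(V, C)`. -/
def star (x₀ : X) (ξ : Boundary X) : Set (Bordification X) :=
  @closure _ (coneTopology x₀)
    (⋃ (C : ℝ) (_ : 0 ≤ C),
      ⋂ (V : Set (Bordification X)) (_ : IsOpen[coneTopology x₀] V) (_ : .atInfinity ξ ∈ V),
        @closure _ (coneTopology x₀) (Bordification.inside '' halfspace x₀ V C))

/-- The set `{ζ ∈ ∂X : ∠(ξ, ζ) ≤ π/2}`, as a subset of the bordification. -/
def rightAngleBall (ξ : Boundary X) : Set (Bordification X) :=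
  Bordification.atInfinity '' {ζ | angle (.atInfinity ξ) (.atInfinity ζ) ≤ Real.pi / 2}

end CatZero

namespace CatZero

universe u

variable {X : Type u} [MetricSpace X]

/-! For ideal `η`, choose `q` with `∠_q(η, ξ⁻) > π/2`. Since `g_n⁻¹ p → ξ⁻`, the angle at `q`
between `η` and `g_n⁻¹ p` eventually exceeds `π/2 - ε`. Applying `g_n`, so does the angle at `g_n q`
between `g_n η` and `p`. Two angles of a triangle, even one with an ideal vertex, add up to at most
`π`, so at `p` the points `g_n q` and `g_n η` are seen at angle less than `π/2 + ε`. As `g_n q →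
ξ⁺`, this bounds `∠_p(ξ⁺, g_n η)`; see `eventually_angleAt_map_le`, built on `angleAt_triangle`,
`angleAt_add_le_pi` and `tendsto_angleAt`. For `η ∈ X` one simply has `g_n η → ξ⁺`.

In a proper space the bordification is compact (`exists_coneTendsto`). Every ultrafilter limit of
`g_n η_n` lies in `B`, unless `η_n` tends to an ideal point within `π/2` of `ξ⁻`
(`limit_mem_rightAngleBall`). Hence the convergence is uniform on any set whose closure contains no
such ideal point (`eventually_map_mem`). Singletons give the second statement. The star of `ξ⁻`
contains all those ideal points (`mem_star_of_angle_le`), which gives the third.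

The metric estimates about segments and rays mostly come from one comparison inequality,
`chord_sq_mul_le`. -/

/-! ### Comparison triangles and the law of cosines. -/

/-- The cosine of the comparison angle. -/
noncomputable def compCos (p x y : X) : ℝ :=
  (dist p x ^ 2 + dist p y ^ 2 - dist x y ^ 2) / (2 * dist p x * dist p y)

lemma comparisonAngle_eq (p x y : X) : comparisonAngle p x y = Real.arccos (compCos p x y) := rfl

lemma compCos_comm (p x y : X) : compCos p x y = compCos p y x := by
  simp only [compCos, dist_comm y x]; ring

lemma dist_sq_eq {p x y : X} (hx : p ≠ x) (hy : p ≠ y) :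
    dist x y ^ 2 = dist p x ^ 2 + dist p y ^ 2 - 2 * dist p x * dist p y * compCos p x y := by
  have := dist_pos.2 hx
  have := dist_pos.2 hy
  unfold compCos; field_simp; ring

lemma abs_compCos_le_one {p x y : X} (hx : p ≠ x) (hy : p ≠ y) : |compCos p x y| ≤ 1 := by
  have h1 := dist_pos.2 hx
  have h2 := dist_pos.2 hy
  have h3 := dist_triangle p x y
  have h4 := dist_triangle p y x
  have h5 := dist_triangle x p y
  rw [dist_comm y x] at h4
  rw [dist_comm x p] at h5
  have := dist_nonneg (x := x) (y := y)
  rw [abs_le, compCos]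
  have h0 : 0 < 2 * dist p x * dist p y := by positivity
  rw [le_div_iff₀ h0, div_le_one h0]
  constructor <;> nlinarith

lemma cos_comparisonAngle {p x y : X} (hx : p ≠ x) (hy : p ≠ y) :
    Real.cos (comparisonAngle p x y) = compCos p x y := by
  have := abs_le.1 (abs_compCos_le_one hx hy)
  exact Real.cos_arccos this.1 this.2

lemma plane_dist {a b c e d : ℝ} (hd : 0 ≤ d) (h : (a - c) ^ 2 + (b - e) ^ 2 = d ^ 2) :
    dist (!₂[a, b] : EuclideanSpace ℝ (Fin 2)) !₂[c, e] = d := by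
  rw [EuclideanSpace.dist_eq, Real.sqrt_eq_iff_eq_sq (by positivity) hd]
  simpa [Fin.sum_univ_two, Real.dist_eq, sq_abs] using h

/-- The law of cosines form of the comparison inequality. -/
lemma IsCAT0.dist_sq_mul_le (h : IsCAT0 X) {p q r x y : X}
    (hx : dist p x + dist x q = dist p q) (hy : dist p y + dist y r = dist p r) :
    dist x y ^ 2 * (dist p q * dist p r) ≤ (dist p x ^ 2 + dist p y ^ 2) * (dist p q * dist p r)
      - dist p x * dist p y * (dist p q ^ 2 + dist p r ^ 2 - dist q r ^ 2) := by
  have hxq := dist_nonneg (x := x) (y := q)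
  have hyr := dist_nonneg (x := y) (y := r)
  have hpx := dist_nonneg (x := p) (y := x)
  have hpy := dist_nonneg (x := p) (y := y)
  rcases eq_or_ne p q with rfl | hq
  · rw [dist_self] at hx
    have : dist p x = 0 := by linarith
    simp [this]
  rcases eq_or_ne p r with rfl | hr
  · rw [dist_self] at hy
    have : dist p y = 0 := by linarith
    simp [this]
  have hA := dist_pos.2 hq
  have hB := dist_pos.2 hr
  have hk := abs_compCos_le_one hq hr
  have hC := dist_sq_eq hq hr
  set k := compCos p q r
  set A := dist p q
  set B := dist p r
  set s := dist p x
  set t := dist p y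
  -- `k` and `m` are the cosine and sine of the comparison angle at `p`; the comparison triangle has
  -- `p'` at the origin and `q'` on the first axis.
  set m := Real.sqrt (1 - k ^ 2)
  have hm : m ^ 2 = 1 - k ^ 2 := Real.sq_sqrt (by nlinarith [abs_le.1 hk])
  have key := h.comparison p q r x y hx hy !₂[0, 0] !₂[A, 0] !₂[B * k, B * m] !₂[s, 0] !₂[t * k, t * m]
    ?_ ?_ ?_ ?_ ?_ ?_ ?_
  · rw [EuclideanSpace.dist_eq] at key
    have h2 : dist x y ^ 2 ≤ s ^ 2 + t ^ 2 - 2 * s * t * k := by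
      have h3 := pow_le_pow_left₀ dist_nonneg key 2
      rw [Real.sq_sqrt (by positivity)] at h3
      simp only [Fin.sum_univ_two, Real.dist_eq, sq_abs] at h3
      simp at h3
      nlinarith
    rw [hC]
    have := mul_le_mul_of_nonneg_right h2 (mul_pos hA hB).le
    nlinarith
  all_goals
    refine plane_dist ?_ ?_
    · positivity
  · ring
  · linear_combination B ^ 2 * hm
  · linear_combination B ^ 2 * hm - hC
  · ring
  · linear_combination (-A + s - dist x q) * hx
  · linear_combination t ^ 2 * hm
  · linear_combination (-B + t - dist y r) * hy + (t - B) ^ 2 * hm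

lemma IsCAT0.compCos_anti (h : IsCAT0 X) {p q r x y : X}
    (hx : dist p x + dist x q = dist p q) (hy : dist p y + dist y r = dist p r)
    (hpx : p ≠ x) (hpy : p ≠ y) : compCos p q r ≤ compCos p x y := by
  have hs := dist_pos.2 hpx
  have ht := dist_pos.2 hpy
  have hA : 0 < dist p q := by linarith [dist_nonneg (x := x) (y := q)]
  have hB : 0 < dist p r := by linarith [dist_nonneg (x := y) (y := r)]
  have := h.dist_sq_mul_le hx hy
  rw [compCos, compCos, div_le_div_iff₀ (by positivity) (by positivity)]
  linarith

lemma IsCAT0.comparisonAngle_mono (h : IsCAT0 X) {p q r x y : X}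
    (hx : dist p x + dist x q = dist p q) (hy : dist p y + dist y r = dist p r)
    (hpx : p ≠ x) (hpy : p ≠ y) : comparisonAngle p x y ≤ comparisonAngle p q r :=
  Real.antitone_arccos (h.compCos_anti hx hy hpx hpy)

/-- For equal distances from `p` the law of cosines collapses to this form. With two long sides and
a third side close to their difference or merely bounded, it forces the two sides to stay together
near `p`. -/
lemma IsCAT0.chord_sq_mul_le (h : IsCAT0 X) {p q r x y : X}
    (hx : dist p x + dist x q = dist p q) (hy : dist p y + dist y r = dist p r)
    (hxy : dist p x = dist p y) :
    dist x y ^ 2 * (dist p q * dist p r) ≤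
      dist p x ^ 2 * (dist q r ^ 2 - (dist p q - dist p r) ^ 2) := by
  have := h.dist_sq_mul_le hx hy
  rw [← hxy] at this
  nlinarith

lemma IsCAT0.between_unique (h : IsCAT0 X) {p q x y : X}
    (hx : dist p x + dist x q = dist p q) (hy : dist p y + dist y q = dist p q)
    (hxy : dist p x = dist p y) : x = y := by
  have key := h.chord_sq_mul_le hx hy hxy
  simp only [dist_self, sub_self] at key
  rcases eq_or_ne p q with rfl | hq
  · rw [dist_self] at hx
    have h1 := dist_nonneg (x := p) (y := x)
    have h2 := dist_nonneg (x := x) (y := p)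
    have h3 : dist p x = 0 := by linarith
    have h4 : dist p y = 0 := by linarith
    rw [← dist_eq_zero.1 h3, ← dist_eq_zero.1 h4]
  · have hA := dist_pos.2 hq
    have : dist x y ^ 2 ≤ 0 := by
      by_contra hn
      have := mul_pos (not_le.1 hn) (mul_pos hA hA)
      linarith
    exact dist_eq_zero.1 (by nlinarith [dist_nonneg (x := x) (y := y)])

/-- If the broken path `p, q, r` exceeds `dist p r` by at most `2 * a`, then `[p, q]` and `[p, r]`
stay close near `p`. -/
lemma IsCAT0.chord_sq_mul_le_of_excess (h : IsCAT0 X) {p q r x y : X} {a : ℝ}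
    (hx : dist p x + dist x q = dist p q) (hy : dist p y + dist y r = dist p r)
    (hxy : dist p x = dist p y) (ha : a ≤ dist p q) (hr : p ≠ r)
    (he : dist p q + dist q r ≤ dist p r + 2 * a) :
    dist x y ^ 2 * dist p q ≤ dist p x ^ 2 * (4 * a) := by
  have key := h.chord_sq_mul_le hx hy hxy
  have hB := dist_pos.2 hr
  have h1 := dist_triangle p q r
  have h2 := dist_triangle p r q
  rw [dist_comm r q] at h2
  -- The difference of squares factors; one factor is at most `2 * a` by the excess bound, the other
  -- at most `2 * dist p r` by the triangle inequality.
  have h3 : dist q r ^ 2 - (dist p q - dist p r) ^ 2 ≤ 4 * a * dist p r := by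
    nlinarith [mul_nonneg (show 0 ≤ 2 * a - (dist q r - (dist p r - dist p q)) by linarith)
      (show 0 ≤ dist q r + (dist p r - dist p q) by linarith),
      mul_nonneg (show 0 ≤ a by linarith)
      (show 0 ≤ 2 * dist p r - (dist q r + (dist p r - dist p q)) by linarith)]
  have h4 := mul_le_mul_of_nonneg_left h3 (sq_nonneg (dist p x))
  refine le_of_mul_le_mul_right ?_ hB
  linarith

/-! ### Segments, rays and their traces. -/

lemma IsCAT0.exists_between (h : IsCAT0 X) (p x : X) {r : ℝ} (hr : 0 ≤ r) (hrx : r ≤ dist p x) :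
    ∃ y, dist p y = r ∧ dist p y + dist y x = dist p x := by
  obtain ⟨γ, h0, h1, hγ⟩ := h.geodesic p x
  have a := hγ 0 ⟨le_rfl, hr.trans hrx⟩ r ⟨hr, hrx⟩
  have b := hγ r ⟨hr, hrx⟩ (dist p x) ⟨hr.trans hrx, le_rfl⟩
  rw [h0, zero_sub, abs_neg, abs_of_nonneg hr] at a
  rw [h1, abs_sub_comm, abs_of_nonneg (by linarith)] at b
  exact ⟨γ r, a, by linarith⟩

lemma IsCAT0.trace_inside_spec (h : IsCAT0 X) (p x : X) (r : ℝ≥0) :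
    dist p (trace p (.inside x) r) = min (r : ℝ) (dist p x) ∧
      dist p (trace p (.inside x) r) + dist (trace p (.inside x) r) x = dist p x :=
  Classical.epsilon_spec (p := fun y => dist p y = min (r : ℝ) (dist p x) ∧
      dist p y + dist y x = dist p x)
    (h.exists_between p x (le_min r.2 dist_nonneg) (min_le_right _ _))

lemma IsCAT0.trace_inside_eq (h : IsCAT0 X) {p x y : X} {r : ℝ≥0}
    (h1 : dist p y = min (r : ℝ) (dist p x)) (h2 : dist p y + dist y x = dist p x) :
    trace p (.inside x) r = y :=
  h.between_unique (h.trace_inside_spec p x r).2 h2 ((h.trace_inside_spec p x r).1.trans h1.symm)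

lemma IsCAT0.trace_inside_of_le (h : IsCAT0 X) {p x : X} {r : ℝ≥0} (hr : dist p x ≤ r) :
    trace p (.inside x) r = x :=
  h.trace_inside_eq (min_eq_right hr).symm (by simp)

lemma IsCAT0.trace_self (h : IsCAT0 X) (p : X) (r : ℝ≥0) : trace p (.inside p) r = p :=
  h.trace_inside_of_le (by simp)

lemma GeodesicRay.dist_eq (c : GeodesicRay X) {s t : ℝ≥0} (hst : s ≤ t) :
    dist (c.1 s) (c.1 t) = t - s := by
  have : (s : ℝ) ≤ t := hst
  rw [c.2.dist_eq, NNReal.dist_eq, abs_sub_comm, abs_of_nonneg (by linarith)]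

lemma GeodesicRay.dist_zero (c : GeodesicRay X) (t : ℝ≥0) : dist (c.1 0) (c.1 t) = t := by
  simpa using c.dist_eq (zero_le : 0 ≤ t)

lemma GeodesicRay.between (c : GeodesicRay X) {s t : ℝ≥0} (hst : s ≤ t) :
    dist (c.1 0) (c.1 s) + dist (c.1 s) (c.1 t) = dist (c.1 0) (c.1 t) := by
  rw [c.dist_zero, c.dist_zero, c.dist_eq hst]; ring

/-- If the rays are `K`-close at time `t`, comparison makes them `r * K / t`-close at time `r`; let
`t` grow. -/
lemma IsCAT0.ray_unique (h : IsCAT0 X) {c c' : GeodesicRay X} (h0 : c.1 0 = c'.1 0)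
    (he : c.endpoint = c'.endpoint) (r : ℝ≥0) : c.1 r = c'.1 r := by
  obtain ⟨K, hK⟩ := Quotient.exact he
  by_contra hne
  have hd := dist_pos.2 hne
  set d := dist (c.1 r) (c'.1 r)
  obtain ⟨t, ht⟩ : ∃ t : ℝ≥0, r ≤ t ∧ 1 ≤ t ∧ (r ^ 2 * K ^ 2 : ℝ) / d ^ 2 < t := by
    obtain ⟨v, hv⟩ : ∃ v : ℝ≥0, (v : ℝ) = (r ^ 2 * K ^ 2 : ℝ) / d ^ 2 :=
      ⟨⟨_, by positivity⟩, rfl⟩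
    refine ⟨r + 1 + v, ?_, ?_, ?_⟩
    · rw [add_assoc]; exact le_self_add
    · rw [add_comm r, add_assoc]; exact le_self_add
    · push_cast
      linarith [r.coe_nonneg]
  obtain ⟨hrt, ht1, ht⟩ := ht
  have key := h.chord_sq_mul_le (c.between hrt) (by rw [h0]; exact c'.between hrt)
    (by rw [c.dist_zero, h0, c'.dist_zero])
  rw [c.dist_zero, c.dist_zero, h0, c'.dist_zero, sub_self] at key
  rw [div_lt_iff₀ (by positivity)] at ht
  have h1 : (1 : ℝ) ≤ t := ht1
  have h2 : dist (c.1 t) (c'.1 t) ^ 2 ≤ K ^ 2 := pow_le_pow_left₀ dist_nonneg (hK t) 2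
  have h3 := mul_le_mul_of_nonneg_left h2 (sq_nonneg (r : ℝ))
  have h4 : (t : ℝ) ≤ t * t := by nlinarith
  have h5 := mul_le_mul_of_nonneg_left h4 (sq_nonneg d)
  change d ^ 2 * _ ≤ _ at key
  nlinarith

/-- Segments from `p` to far points of a geodesic issuing from `x₀` are close near `p`. -/
lemma IsCAT0.exists_trace_dist_lt (h : IsCAT0 X) (p x₀ : X) (r : ℝ≥0) {ε : ℝ} (hε : 0 < ε) :
    ∃ R₀ : ℝ≥0, ∀ y z : X, dist x₀ y + dist y z = dist x₀ z → (R₀ : ℝ) ≤ dist x₀ y →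
      dist (trace p (.inside y) r) (trace p (.inside z) r) < ε := by
  have ha := dist_nonneg (x := p) (y := x₀)
  set a := dist p x₀ with ha'
  have hq : 0 ≤ r ^ 2 * (4 * a) / ε ^ 2 := by positivity
  -- Passing from `x₀` to `p` costs one `a`; what remains gives `a ≤ dist p y`, `r ≤ dist p y` and a
  -- chord below `ε`. The excess of the path `p, y, z` is at most `2 * a` because `y` lies on `[x₀,
  -- z]`.
  refine ⟨⟨2 * a + r + r ^ 2 * (4 * a) / ε ^ 2 + 1, by positivity⟩, fun y z hyz hy => ?_⟩
  change 2 * a + r + r ^ 2 * (4 * a) / ε ^ 2 + 1 ≤ _ at hy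
  have hr := r.2
  have h1 := dist_triangle x₀ p y
  have h2 := dist_triangle x₀ p z
  have h3 := dist_triangle p x₀ y
  have h4 := dist_nonneg (x := y) (y := z)
  rw [dist_comm x₀ p] at h1 h2
  change (0 : ℝ) ≤ r at hr
  have hry : (r : ℝ) ≤ dist p y := by linarith
  have hrz : (r : ℝ) ≤ dist p z := by linarith
  obtain ⟨y1, y2⟩ := h.trace_inside_spec p y r
  obtain ⟨z1, z2⟩ := h.trace_inside_spec p z r
  rw [min_eq_left hry] at y1
  rw [min_eq_left hrz] at z1
  have key := h.chord_sq_mul_le_of_excess (a := a) y2 z2 (y1.trans z1.symm) (by linarith)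
    (dist_pos.1 (by linarith)) (by linarith)
  rw [y1] at key
  have h5 : r ^ 2 * (4 * a) / ε ^ 2 < dist p y := by linarith
  rw [div_lt_iff₀ (by positivity)] at h5
  have h6 : 0 < dist p y := by linarith
  refine lt_of_pow_lt_pow_left₀ 2 hε.le ?_
  refine lt_of_mul_lt_mul_right (a := dist p y) ?_ h6.le
  linarith

/-- Compare at the far vertex `c.1 T`: the point `w` of the ray as far from that vertex as the trace
is within `a = dist p (c.1 0)` of the trace, and within `a` of `c.1 r`. If the ray is too short for
`w` to exist, then `r < a` and the path through `p` and `c.1 0` gives `3 * a`. -/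
lemma IsCAT0.dist_trace_ray_le (h : IsCAT0 X) (p : X) (c : GeodesicRay X) {r T : ℝ≥0}
    (hT : 0 < T) (hA : (r : ℝ) < dist p (c.1 T)) :
    dist (trace p (.inside (c.1 T)) r) (c.1 r) ≤ 3 * dist p (c.1 0) := by
  obtain ⟨x1, x2⟩ := h.trace_inside_spec p (c.1 T) r
  rw [min_eq_left hA.le] at x1
  set x := trace p (.inside (c.1 T)) r
  set q := c.1 T with hq
  have ha := dist_nonneg (x := p) (y := c.1 0)
  set a := dist p (c.1 0) with haa
  have hr : (0 : ℝ) ≤ r := r.2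
  have hT' : (0 : ℝ) < T := hT
  have hcT := c.dist_zero T
  have t1 := dist_triangle p (c.1 0) q
  have t2 := dist_triangle (c.1 0) p q
  rw [dist_comm (c.1 0) p] at t2
  rcases le_or_gt (dist p q - r) T with hle | hgt
  · have hρ : 0 ≤ dist p q - r := by linarith
    obtain ⟨S, hS⟩ : ∃ S : ℝ≥0, (S : ℝ) = T - (dist p q - r) := ⟨⟨_, by linarith⟩, rfl⟩
    have hST : S ≤ T := by rw [← NNReal.coe_le_coe]; linarith
    set w := c.1 S with hw
    have w1 : dist w q = dist p q - r := by
      rw [hw, hq, c.dist_eq hST, hS]; ring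
    have w2 : dist w (c.1 r) ≤ a := by
      rw [hw, c.2.dist_eq, NNReal.dist_eq, hS, abs_le]
      constructor <;> linarith
    have w3 : dist (c.1 0) w = T - (dist p q - r) := by rw [hw, c.dist_zero, hS]
    have key := h.chord_sq_mul_le (p := q) (q := p) (r := c.1 0) (x := x) (y := w)
      (by rw [dist_comm q x, dist_comm x p, dist_comm q p]; linarith)
      (by rw [dist_comm q w, dist_comm w (c.1 0), dist_comm q (c.1 0), w1, w3, hcT]; ring)
      (by rw [dist_comm q x, dist_comm q w, w1]; linarith)
    rw [dist_comm q x, dist_comm q p, dist_comm q (c.1 0), hcT, ← haa] at key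
    have e1 : dist x q = dist p q - r := by linarith
    rw [e1] at key
    have e2 : (dist p q - r) ^ 2 * (a ^ 2 - (dist p q - T) ^ 2) ≤ a ^ 2 * (dist p q * T) := by
      have : (dist p q - r) ^ 2 ≤ dist p q * T := by nlinarith
      nlinarith [mul_le_mul_of_nonneg_right this (sq_nonneg a),
        mul_nonneg (sq_nonneg (dist p q - r)) (sq_nonneg (dist p q - T))]
    have e3 : dist x w ^ 2 ≤ a ^ 2 :=
      le_of_mul_le_mul_right (key.trans e2) (mul_pos (by linarith) hT')
    have e4 := abs_le_of_sq_le_sq e3 ha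
    linarith [dist_triangle x w (c.1 r), (abs_le.1 e4).2]
  · have := c.dist_zero r
    have h3 := dist_triangle4 x p (c.1 0) (c.1 r)
    rw [dist_comm x p] at h3
    linarith

lemma isometry_of_dist_eq_sub {f : ℝ≥0 → X} (hd : ∀ r s, r ≤ s → dist (f r) (f s) = s - r) :
    Isometry f := by
  refine Isometry.of_dist_eq fun r s => ?_
  rw [NNReal.dist_eq]
  rcases le_total r s with hrs | hrs
  · have : (r : ℝ) ≤ s := hrs
    rw [hd r s hrs, abs_sub_comm, abs_of_nonneg (by linarith)]
  · have : (s : ℝ) ≤ r := hrs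
    rw [dist_comm, hd s r hrs, abs_of_nonneg (by linarith)]

/-- The segments from `p` to `c.1 T` are Cauchy on bounded sets, and their limit is the required
ray; the bound independent of `T` makes it asymptotic to `c`. -/
lemma IsCAT0.exists_ray [CompleteSpace X] (h : IsCAT0 X) (p : X) (c : GeodesicRay X) :
    ∃ c' : GeodesicRay X, c'.1 0 = p ∧ c'.endpoint = c.endpoint ∧
      ∀ r, Tendsto (fun T => trace p (.inside (c.1 T)) r) atTop (𝓝 (c'.1 r)) := by
  have hc : ∀ r, ∃ y, Tendsto (fun T => trace p (.inside (c.1 T)) r) atTop (𝓝 y) := by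
    intro r
    apply cauchySeq_tendsto_of_complete
    rw [Metric.cauchySeq_iff']
    intro ε hε
    obtain ⟨R₀, hR⟩ := h.exists_trace_dist_lt p (c.1 0) r hε
    refine ⟨R₀, fun n hn => ?_⟩
    rw [dist_comm]
    exact hR _ _ (c.between hn) (by rw [c.dist_zero])
  choose f hf using hc
  have far : ∀ r : ℝ≥0, ∀ᶠ T : ℝ≥0 in atTop, (r : ℝ) < dist p (c.1 T) := by
    intro r
    filter_upwards [eventually_gt_atTop (r + nndist p (c.1 0))] with T hT
    have : (r : ℝ) + dist p (c.1 0) < T := hT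
    have h2 := dist_triangle (c.1 0) p (c.1 T)
    rw [c.dist_zero, dist_comm (c.1 0)] at h2
    linarith
  have hd : ∀ r s, r ≤ s → dist (f r) (f s) = s - r := by
    intro r s hrs
    have hrs' : (r : ℝ) ≤ s := hrs
    refine tendsto_nhds_unique ((hf r).dist (hf s)) (tendsto_const_nhds.congr' ?_)
    filter_upwards [far s] with T hT
    obtain ⟨x1, x2⟩ := h.trace_inside_spec p (c.1 T) s
    obtain ⟨y1, y2⟩ := h.trace_inside_spec p (c.1 T) r
    rw [min_eq_left hT.le] at x1
    rw [min_eq_left (by linarith)] at y1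
    obtain ⟨w, w1, w2⟩ := h.exists_between p (trace p (.inside (c.1 T)) s)
      r.coe_nonneg (by rw [x1]; exact hrs)
    have : trace p (.inside (c.1 T)) r = w := by
      refine h.trace_inside_eq (w1.trans (min_eq_left (by linarith)).symm) (le_antisymm ?_
        (dist_triangle _ _ _))
      linarith [dist_triangle w (trace p (.inside (c.1 T)) s) (c.1 T)]
    rw [this]
    change dist p w = r at w1
    linarith
  refine ⟨⟨f, isometry_of_dist_eq_sub hd⟩, ?_, ?_, hf⟩
  · refine tendsto_nhds_unique (hf 0) (tendsto_const_nhds.congr fun T => ?_)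
    have := (h.trace_inside_spec p (c.1 T) 0).1
    simp only [NNReal.coe_zero, min_eq_left dist_nonneg] at this
    exact dist_eq_zero.1 this
  · refine Quotient.sound ⟨3 * dist p (c.1 0), fun r => ?_⟩
    refine le_of_tendsto ((hf r).dist tendsto_const_nhds) ?_
    filter_upwards [far r, eventually_gt_atTop 0] with T hT hT0
    exact h.dist_trace_ray_le p c hT0 hT

lemma IsCAT0.trace_endpoint (h : IsCAT0 X) (c : GeodesicRay X) (r : ℝ≥0) :
    trace (c.1 0) (.atInfinity c.endpoint) r = c.1 r := by
  have hex : ∃ y, ∃ c' : GeodesicRay X, c'.1 0 = c.1 0 ∧ c'.endpoint = c.endpoint ∧ c'.1 r = y :=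
    ⟨_, c, rfl, rfl, rfl⟩
  obtain ⟨c', h0, h1, h2⟩ := Classical.epsilon_spec hex
  exact h2.symm.trans (h.ray_unique h0 h1 r)

lemma IsCAT0.exists_ray_trace [CompleteSpace X] (h : IsCAT0 X) (p : X) (ξ : Boundary X) :
    ∃ c : GeodesicRay X, c.1 0 = p ∧ c.endpoint = ξ ∧ ∀ r, trace p (.atInfinity ξ) r = c.1 r := by
  obtain ⟨b, rfl⟩ := Quotient.exists_rep ξ
  obtain ⟨c, h0, h1, -⟩ := h.exists_ray p b
  refine ⟨c, h0, h1, fun r => ?_⟩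
  have := h.trace_endpoint c r
  rwa [h0, h1] at this

lemma IsCAT0.tendsto_trace_ray [CompleteSpace X] (h : IsCAT0 X) (p : X) (c : GeodesicRay X)
    (r : ℝ≥0) : Tendsto (fun T => trace p (.inside (c.1 T)) r) atTop
      (𝓝 (trace p (.atInfinity c.endpoint) r)) := by
  obtain ⟨c', h0, h1, h2⟩ := h.exists_ray p c
  have := h.trace_endpoint c' r
  rw [h0, h1] at this
  rw [this]
  exact h2 r

lemma tendsto_nhds_coneTopology {x₀ : X} {ι : Type*} {z : ι → Bordification X}
    {l : Filter ι} {ζ : Bordification X} :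
    Tendsto z l (@nhds _ (coneTopology x₀) ζ) ↔
      ∀ r, Tendsto (fun i => trace x₀ (z i) r) l (𝓝 (trace x₀ ζ r)) := by
  rw [nhds_induced, tendsto_comap_iff, tendsto_pi_nhds]
  rfl

/-! ### Elementary facts on comparison and Alexandrov angles. -/

/-- A point on the base of an isosceles Euclidean triangle dividing its apex angle into `θ₁` and
`θ₂`. -/
lemma exists_isosceles_division {s θ₁ θ₂ : ℝ} (hs : 0 < s) (h₁ : 0 < θ₁) (h₂ : 0 < θ₂)
    (h : θ₁ + θ₂ < Real.pi) :
    ∃ r u v : ℝ, 0 < r ∧ r ≤ s ∧ 0 ≤ u ∧ 0 ≤ v ∧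
      s ^ 2 + r ^ 2 - 2 * s * r * Real.cos θ₁ = u ^ 2 ∧
      s ^ 2 + r ^ 2 - 2 * s * r * Real.cos θ₂ = v ^ 2 ∧
      (u + v) ^ 2 = 2 * s ^ 2 - 2 * s ^ 2 * Real.cos (θ₁ + θ₂) := by
  obtain ⟨φ, ψ, rfl, rfl⟩ : ∃ φ ψ, θ₁ = φ + ψ ∧ θ₂ = φ - ψ :=
    ⟨(θ₁ + θ₂) / 2, (θ₁ - θ₂) / 2, by ring, by ring⟩
  have hψ : 0 < Real.cos ψ := Real.cos_pos_of_mem_Ioo ⟨by linarith, by linarith⟩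
  have hφ : 0 < Real.cos φ := Real.cos_pos_of_mem_Ioo ⟨by linarith, by linarith⟩
  have hle : Real.cos φ ≤ Real.cos ψ := by
    rw [← Real.cos_abs ψ]
    refine Real.cos_le_cos_of_nonneg_of_le_pi (abs_nonneg _) (by linarith) ?_
    rw [abs_le]; constructor <;> linarith
  have hp : 0 < Real.sin (φ + ψ) := Real.sin_pos_of_pos_of_lt_pi h₁ (by linarith)
  have hm : 0 < Real.sin (φ - ψ) := Real.sin_pos_of_pos_of_lt_pi h₂ (by linarith)
  have eφ := Real.sin_sq_add_cos_sq φ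
  have eψ := Real.sin_sq_add_cos_sq ψ
  -- The altitude is `s * cos φ`, and the dividing segment makes the angle `ψ` with it; `u` and `v`
  -- are the two pieces of the base.
  refine ⟨s * Real.cos φ / Real.cos ψ, s * Real.sin (φ + ψ) / Real.cos ψ,
    s * Real.sin (φ - ψ) / Real.cos ψ, by positivity, ?_, by positivity, by positivity,
    ?_, ?_, ?_⟩
  · rw [div_le_iff₀ hψ]; gcongr
  · rw [Real.cos_add, Real.sin_add]
    field_simp
    linear_combination (-(Real.cos ψ ^ 2)) * eφ + Real.cos φ ^ 2 * (-eψ)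
  · rw [Real.cos_sub, Real.sin_sub]
    field_simp
    linear_combination (-(Real.cos ψ ^ 2)) * eφ + Real.cos φ ^ 2 * (-eψ)
  · rw [show φ + ψ + (φ - ψ) = 2 * φ by ring, Real.cos_two_mul, Real.sin_sub, Real.sin_add]
    field_simp
    linear_combination 4 * Real.cos ψ ^ 2 * eφ

lemma comparisonAngle_nonneg (p x y : X) : 0 ≤ comparisonAngle p x y := Real.arccos_nonneg _

lemma comparisonAngle_le_pi (p x y : X) : comparisonAngle p x y ≤ Real.pi := Real.arccos_le_pi _

lemma comparisonAngle_comm (p x y : X) : comparisonAngle p x y = comparisonAngle p y x := by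
  rw [comparisonAngle_eq, comparisonAngle_eq, compCos_comm]

lemma comparisonAngle_self {p x : X} (h : p ≠ x) : comparisonAngle p x x = 0 := by
  have := dist_pos.2 h
  rw [comparisonAngle, dist_self, Real.arccos_eq_zero, le_div_iff₀ (by positivity)]
  nlinarith

/-- The sum of the two cosines factors into terms that are nonnegative by the triangle inequality.
-/
lemma comparisonAngle_add_le_pi {p q x : X} (hpq : p ≠ q) (hp : p ≠ x) (hq : q ≠ x) :
    comparisonAngle p q x + comparisonAngle q p x ≤ Real.pi := by
  rw [← le_sub_iff_add_le, comparisonAngle, comparisonAngle, ← Real.arccos_neg]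
  apply Real.antitone_arccos
  rw [dist_comm q p]
  have h1 := dist_pos.2 hpq
  have h2 := dist_pos.2 hp
  have h3 := dist_pos.2 hq
  rw [← sub_nonneg]
  have : (dist p q ^ 2 + dist p x ^ 2 - dist q x ^ 2) / (2 * dist p q * dist p x) -
      -((dist p q ^ 2 + dist q x ^ 2 - dist p x ^ 2) / (2 * dist p q * dist q x)) =
      (dist p x + dist q x) * ((dist p q - (dist p x - dist q x)) *
        (dist p q + (dist p x - dist q x))) / (2 * dist p q * dist p x * dist q x) := by
    field_simp; ring
  rw [this]
  have t1 := dist_triangle p q x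
  have t2 := dist_triangle q p x
  rw [dist_comm q p] at t2
  have := mul_nonneg (show 0 ≤ dist p q - (dist p x - dist q x) by linarith)
    (show 0 ≤ dist p q + (dist p x - dist q x) by linarith)
  positivity

lemma isBoundedUnder_comparisonAngle {ι : Type*} (l : Filter ι) (p : X) (f g : ι → X) :
    IsBoundedUnder (· ≤ ·) l fun i => comparisonAngle p (f i) (g i) :=
  isBoundedUnder_of ⟨Real.pi, fun _ => comparisonAngle_le_pi _ _ _⟩

lemma isCoboundedUnder_comparisonAngle {ι : Type*} (l : Filter ι) [l.NeBot] (p : X) (f g : ι → X) :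
    IsCoboundedUnder (· ≤ ·) l fun i => comparisonAngle p (f i) (g i) :=
  (isBoundedUnder_of ⟨0, fun _ => comparisonAngle_nonneg _ _ _⟩ :
    IsBoundedUnder (· ≥ ·) l _).isCoboundedUnder_le

lemma nhdsGT_zero_le {a b : ℝ≥0} (ha : 0 < a) (hb : 0 < b) :
    ∀ᶠ st : ℝ≥0 × ℝ≥0 in 𝓝[>] 0 ×ˢ 𝓝[>] 0, (0 < st.1 ∧ st.1 ≤ a) ∧ (0 < st.2 ∧ st.2 ≤ b) :=
  prod_mem_prod (Ioc_mem_nhdsGT ha) (Ioc_mem_nhdsGT hb)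

lemma angleAt_nonneg (p : X) (ξ η : Bordification X) : 0 ≤ angleAt p ξ η :=
  le_limsup_of_frequently_le (Frequently.of_forall fun _ => comparisonAngle_nonneg _ _ _)
    (isBoundedUnder_comparisonAngle _ _ _ _)

lemma angleAt_le_pi (p : X) (ξ η : Bordification X) : angleAt p ξ η ≤ Real.pi :=
  limsup_le_of_le (isCoboundedUnder_comparisonAngle _ _ _ _)
    (Eventually.of_forall fun _ => comparisonAngle_le_pi _ _ _)

lemma angleAt_comm (p : X) (ξ η : Bordification X) : angleAt p ξ η = angleAt p η ξ := by
  unfold angleAt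
  conv_lhs => rw [prod_comm]
  rw [limsup, limsup, map_map]
  congr 2
  ext st
  exact comparisonAngle_comm _ _ _

lemma angleAt_le_angle {p : X} {ξ η : Bordification X} (hξ : .inside p ≠ ξ) (hη : .inside p ≠ η) :
    angleAt p ξ η ≤ angle ξ η :=
  le_ciSup (f := fun p : {p : X // .inside p ≠ ξ ∧ .inside p ≠ η} => angleAt p.1 ξ η)
    ⟨Real.pi, by rintro _ ⟨p, rfl⟩; exact angleAt_le_pi _ _ _⟩ ⟨p, hξ, hη⟩

lemma exists_lt_angleAt {ξ η : Bordification X} {a : ℝ} (ha : 0 ≤ a) (h : a < angle ξ η) :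
    ∃ p : X, .inside p ≠ ξ ∧ .inside p ≠ η ∧ a < angleAt p ξ η := by
  unfold angle at h
  -- A real supremum over the empty type is `0`, which `0 ≤ a` excludes.
  rcases isEmpty_or_nonempty {p : X // .inside p ≠ ξ ∧ .inside p ≠ η} with _ | _
  · rw [Real.iSup_of_isEmpty] at h
    exact (ha.not_gt h).elim
  · obtain ⟨⟨p, h1, h2⟩, h3⟩ := exists_lt_of_lt_ciSup h
    exact ⟨p, h1, h2, h3⟩

lemma Bordification.eq_of_map_eq_inside {g : X ≃ᵢ X} {η : Bordification X} {y : X}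
    (e : η.map g = .inside y) : η = .inside (g.symm y) := by
  cases η with
  | inside x =>
    rw [Bordification.map, Bordification.inside.injEq] at e
    rw [← e, g.symm_apply_apply]
  | atInfinity ξ => simp [Bordification.map] at e

variable [CompleteSpace X]

/-! ### Traces on the bordification and independence of the base point. -/

lemma IsCAT0.dist_trace_atInfinity (h : IsCAT0 X) (p : X) (ξ : Boundary X) (r : ℝ≥0) :
    dist p (trace p (.atInfinity ξ) r) = r := by
  obtain ⟨c, h0, -, h2⟩ := h.exists_ray_trace p ξ
  rw [h2, ← h0, c.dist_zero]

lemma IsCAT0.dist_trace_le (h : IsCAT0 X) (p : X) (ξ : Bordification X) (r : ℝ≥0) :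
    dist p (trace p ξ r) ≤ r := by
  cases ξ with
  | inside x => rw [(h.trace_inside_spec p x r).1]; exact min_le_left _ _
  | atInfinity ξ => exact (h.dist_trace_atInfinity p ξ r).le

lemma IsCAT0.trace_zero (h : IsCAT0 X) (p : X) (ξ : Bordification X) : trace p ξ 0 = p :=
  (dist_eq_zero.1 (le_antisymm (h.dist_trace_le p ξ 0) dist_nonneg)).symm

lemma IsCAT0.trace_between (h : IsCAT0 X) (p : X) (ξ : Bordification X) {r s : ℝ≥0} (hrs : r ≤ s) :
    dist p (trace p ξ r) + dist (trace p ξ r) (trace p ξ s) = dist p (trace p ξ s) := by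
  cases ξ with
  | inside x =>
    have hrs' : (r : ℝ) ≤ s := hrs
    obtain ⟨x1, x2⟩ := h.trace_inside_spec p x s
    obtain ⟨w, w1, w2⟩ := h.exists_between p (trace p (.inside x) s) (r := min r (dist p x))
      (le_min r.2 dist_nonneg) (by rw [x1]; gcongr)
    have : trace p (.inside x) r = w := by
      refine h.trace_inside_eq w1 (le_antisymm ?_ (dist_triangle _ _ _))
      linarith [dist_triangle w (trace p (.inside x) s) x]
    rw [this, w2]
  | atInfinity ξ =>
    obtain ⟨c, h0, -, h2⟩ := h.exists_ray_trace p ξ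
    rw [h2, h2, ← h0, c.between hrs]

lemma IsCAT0.dist_trace_min (h : IsCAT0 X) (p : X) (ξ : Bordification X) (r s : ℝ≥0) :
    dist p (trace p ξ (min r s)) = min (r : ℝ) (dist p (trace p ξ s)) := by
  cases ξ with
  | inside x =>
    rw [(h.trace_inside_spec p x _).1, (h.trace_inside_spec p x _).1, NNReal.coe_min, min_assoc]
  | atInfinity ξ => rw [h.dist_trace_atInfinity, h.dist_trace_atInfinity, NNReal.coe_min]

lemma IsCAT0.trace_trace (h : IsCAT0 X) (p : X) (ξ : Bordification X) (r s : ℝ≥0) :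
    trace p (.inside (trace p ξ s)) r = trace p ξ (min r s) :=
  h.trace_inside_eq (h.dist_trace_min p ξ r s) (h.trace_between p ξ (min_le_right _ _))

lemma IsCAT0.trace_map (h : IsCAT0 X) (g : X ≃ᵢ X) (p : X) (ξ : Bordification X) (r : ℝ≥0) :
    trace (g p) (ξ.map g) r = g (trace p ξ r) := by
  cases ξ with
  | inside x =>
    obtain ⟨x1, x2⟩ := h.trace_inside_spec p x r
    exact h.trace_inside_eq (by rwa [g.dist_eq, g.dist_eq])
      (by rwa [g.dist_eq, g.dist_eq, g.dist_eq])
  | atInfinity ξ =>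
    obtain ⟨c, h0, h1, h2⟩ := h.exists_ray_trace p ξ
    have := h.trace_endpoint (c.map g) r
    rw [h2, ← h0, ← h1]
    exact this

/-- The constant `2` is not sharp. It only serves the case where one of the points lies inside the
ball, settled by the triangle inequality. -/
lemma IsCAT0.dist_trace_trace_le (h : IsCAT0 X) (p y z : X) (r : ℝ≥0) :
    dist (trace p (.inside y) r) (trace p (.inside z) r) ≤ 2 * dist y z := by
  wlog hyz : dist p y ≤ dist p z generalizing y z
  · rw [dist_comm, dist_comm y]; exact this z y (le_of_not_ge hyz)
  obtain ⟨y1, y2⟩ := h.trace_inside_spec p y r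
  obtain ⟨z1, z2⟩ := h.trace_inside_spec p z r
  have hr : (0 : ℝ) ≤ r := r.2
  have hyz0 := dist_nonneg (x := y) (y := z)
  rcases le_or_gt (r : ℝ) (dist p y) with hry | hry
  · rcases eq_or_ne r 0 with rfl | hr0
    · rw [h.trace_zero, h.trace_zero, dist_self]; positivity
    have hr0' : (0 : ℝ) < r := lt_of_le_of_ne hr (by exact_mod_cast hr0.symm)
    rw [min_eq_left hry] at y1
    rw [min_eq_left (hry.trans hyz)] at z1
    have key := h.chord_sq_mul_le y2 z2 (y1.trans z1.symm)
    rw [y1] at key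
    have hA : 0 < dist p y := by linarith
    have e : (r : ℝ) ^ 2 ≤ dist p y * dist p z := by nlinarith
    have e2 : dist (trace p (.inside y) r) (trace p (.inside z) r) ^ 2 ≤ dist y z ^ 2 := by
      refine le_of_mul_le_mul_right (key.trans ?_) (mul_pos hA (hA.trans_le hyz))
      nlinarith [mul_le_mul_of_nonneg_right e (sq_nonneg (dist y z)),
        mul_nonneg (sq_nonneg (r : ℝ)) (sq_nonneg (dist p y - dist p z))]
    have := abs_le_of_sq_le_sq e2 hyz0
    linarith [(abs_le.1 this).2]
  · rw [h.trace_inside_of_le hry.le]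
    have h1 := dist_triangle y z (trace p (.inside z) r)
    have h2 := dist_triangle p y z
    rw [dist_comm z] at h1
    have h3 : dist p y ≤ min (r : ℝ) (dist p z) := le_min hry.le hyz
    linarith

/-- Near `p`, the segment or ray from `p` to `ζ` is uniformly close to the segment from `p` to a far
point of the segment or ray from `x₀` to `ζ`. -/
lemma IsCAT0.exists_dist_trace_le (h : IsCAT0 X) (p x₀ : X) (r : ℝ≥0) {ε : ℝ} (hε : 0 < ε) :
    ∃ R₀ : ℝ≥0, ∀ (ζ : Bordification X) (R : ℝ≥0), R₀ ≤ R →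
      dist (trace p (.inside (trace x₀ ζ R)) r) (trace p ζ r) ≤ ε := by
  obtain ⟨R₀, hR₀⟩ := h.exists_trace_dist_lt p x₀ r hε
  refine ⟨R₀, fun ζ R hR => ?_⟩
  cases ζ with
  | inside z =>
    rcases le_or_gt (dist x₀ z) R with hz | hz
    · rw [h.trace_inside_of_le hz, dist_self]; exact hε.le
    · obtain ⟨y1, y2⟩ := h.trace_inside_spec x₀ z R
      rw [min_eq_left hz.le] at y1
      exact (hR₀ _ _ y2 (by rw [y1]; exact hR)).le
  | atInfinity ξ =>
    obtain ⟨c, h0, rfl, h2⟩ := h.exists_ray_trace x₀ ξ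
    rw [h2]
    refine le_of_tendsto (tendsto_const_nhds.dist (h.tendsto_trace_ray p c r)) ?_
    filter_upwards [eventually_ge_atTop R] with T hT
    refine (hR₀ _ _ ?_ ?_).le
    · rw [← h0]; exact c.between hT
    · rw [← h0, c.dist_zero]; exact hR

/-- Convergence in the cone topology, without reference to a base point. -/
def ConeTendsto {ι : Type*} (z : ι → Bordification X) (l : Filter ι) (ζ : Bordification X) : Prop :=
  ∀ (p : X) (r : ℝ≥0), Tendsto (fun i => trace p (z i) r) l (𝓝 (trace p ζ r))

/-- The trace from `p` is, uniformly over the bordification, almost a Lipschitz function of a far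
trace from `x₀`. -/
lemma IsCAT0.coneTendsto_of (h : IsCAT0 X) (x₀ : X) {ι : Type*} {z : ι → Bordification X}
    {l : Filter ι} {ζ : Bordification X}
    (H : ∀ r, Tendsto (fun i => trace x₀ (z i) r) l (𝓝 (trace x₀ ζ r))) : ConeTendsto z l ζ := by
  intro p r
  rw [Metric.tendsto_nhds]
  intro ε hε
  obtain ⟨R, hR⟩ := h.exists_dist_trace_le p x₀ r (ε := ε / 4) (by positivity)
  filter_upwards [Metric.tendsto_nhds.1 (H R) (ε / 8) (by positivity)] with i hi
  have h1 := hR (z i) R le_rfl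
  have h2 := hR ζ R le_rfl
  have h3 := h.dist_trace_trace_le p (trace x₀ (z i) R) (trace x₀ ζ R) r
  rw [dist_comm] at h1
  linarith [dist_triangle4 (trace p (z i) r) (trace p (.inside (trace x₀ (z i) R)) r)
    (trace p (.inside (trace x₀ ζ R)) r) (trace p ζ r)]

lemma IsCAT0.coneTendsto_iff (h : IsCAT0 X) (x₀ : X) {ι : Type*} {z : ι → Bordification X}
    {l : Filter ι} {ζ : Bordification X} :
    ConeTendsto z l ζ ↔ Tendsto z l (@nhds _ (coneTopology x₀) ζ) := by
  rw [tendsto_nhds_coneTopology]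
  exact ⟨fun H => H x₀, h.coneTendsto_of x₀⟩

/-! ### Alexandrov angles at points and in the limit. -/

lemma IsCAT0.trace_ne (h : IsCAT0 X) {p : X} {ξ : Bordification X} (hξ : .inside p ≠ ξ) {r : ℝ≥0}
    (hr : 0 < r) : p ≠ trace p ξ r := by
  have hr' : (0 : ℝ) < r := hr
  rw [← dist_pos]
  cases ξ with
  | inside x =>
    rw [(h.trace_inside_spec p x r).1]
    exact lt_min hr' (dist_pos.2 fun e => hξ (by rw [e]))
  | atInfinity ξ => rwa [h.dist_trace_atInfinity]

lemma IsCAT0.comparisonAngle_trace_mono (h : IsCAT0 X) {p : X} {ξ η : Bordification X}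
    (hξ : .inside p ≠ ξ) (hη : .inside p ≠ η) {s s' t t' : ℝ≥0} (hs : 0 < s) (hs' : s ≤ s')
    (ht : 0 < t) (ht' : t ≤ t') :
    comparisonAngle p (trace p ξ s) (trace p η t) ≤
      comparisonAngle p (trace p ξ s') (trace p η t') :=
  h.comparisonAngle_mono (h.trace_between p ξ hs') (h.trace_between p η ht')
    (h.trace_ne hξ hs) (h.trace_ne hη ht)

lemma IsCAT0.angleAt_le_comparisonAngle (h : IsCAT0 X) {p : X} {ξ η : Bordification X}
    (hξ : .inside p ≠ ξ) (hη : .inside p ≠ η) {s t : ℝ≥0} (hs : 0 < s) (ht : 0 < t) :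
    angleAt p ξ η ≤ comparisonAngle p (trace p ξ s) (trace p η t) := by
  refine limsup_le_of_le (isCoboundedUnder_comparisonAngle _ _ _ _) ?_
  filter_upwards [nhdsGT_zero_le hs ht] with st hst
  exact h.comparisonAngle_trace_mono hξ hη hst.1.1 hst.1.2 hst.2.1 hst.2.2

lemma IsCAT0.exists_comparisonAngle_lt (h : IsCAT0 X) {p : X} {ξ η : Bordification X}
    (hξ : .inside p ≠ ξ) (hη : .inside p ≠ η) {a : ℝ} (ha : angleAt p ξ η < a) :
    ∃ δ : ℝ≥0, 0 < δ ∧ ∀ s t, 0 < s → s ≤ δ → 0 < t → t ≤ δ →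
      comparisonAngle p (trace p ξ s) (trace p η t) < a := by
  have h1 := eventually_lt_of_limsup_lt ha (isBoundedUnder_comparisonAngle _ _ _ _)
  obtain ⟨⟨s, t⟩, h2, hs, ht⟩ := (h1.and (nhdsGT_zero_le one_pos one_pos)).exists
  refine ⟨min s t, lt_min hs.1 ht.1, fun s' t' hs' hss ht' htt => ?_⟩
  exact (h.comparisonAngle_trace_mono hξ hη hs' (hss.trans (min_le_left _ _)) ht'
    (htt.trans (min_le_right _ _))).trans_lt h2

lemma IsCAT0.exists_dist_trace_eq (h : IsCAT0 X) {p : X} {ξ : Bordification X}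
    (hξ : .inside p ≠ ξ) : ∃ δ : ℝ≥0, 0 < δ ∧ ∀ s ≤ δ, dist p (trace p ξ s) = s := by
  cases ξ with
  | inside x =>
    refine ⟨nndist p x, dist_pos.2 fun e => hξ (by rw [e]), fun s hs => ?_⟩
    rw [(h.trace_inside_spec p x s).1]
    exact min_eq_left hs
  | atInfinity ξ => exact ⟨1, one_pos, fun s _ => h.dist_trace_atInfinity p ξ s⟩

/-- If it failed, a Euclidean isosceles triangle with apex angle `θ₁ + θ₂ < π` would exist, divided
into `θ₁` and `θ₂`. At small scale the path `x, y, z` is no longer than its base `u + v`, while the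
comparison angle of `x, z` exceeds `θ₁ + θ₂`, so `dist x z` is longer. -/
lemma IsCAT0.angleAt_triangle (h : IsCAT0 X) {p : X} {ξ η ζ : Bordification X}
    (hξ : .inside p ≠ ξ) (hη : .inside p ≠ η) (hζ : .inside p ≠ ζ) :
    angleAt p ξ ζ ≤ angleAt p ξ η + angleAt p η ζ := by
  by_contra! hlt
  obtain ⟨ε, hε, hsum⟩ : ∃ ε, 0 < ε ∧ (angleAt p ξ η + ε) + (angleAt p η ζ + ε) < angleAt p ξ ζ :=
    ⟨(angleAt p ξ ζ - (angleAt p ξ η + angleAt p η ζ)) / 4, by linarith, by linarith⟩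
  have hα := angleAt_nonneg p ξ η
  have hβ := angleAt_nonneg p η ζ
  have hγ := angleAt_le_pi p ξ ζ
  obtain ⟨δ₁, p₁, h₁⟩ := h.exists_comparisonAngle_lt hξ hη (lt_add_of_pos_right _ hε)
  obtain ⟨δ₂, p₂, h₂⟩ := h.exists_comparisonAngle_lt hη hζ (lt_add_of_pos_right _ hε)
  obtain ⟨δ₃, p₃, h₃⟩ := h.exists_dist_trace_eq hξ
  obtain ⟨δ₄, p₄, h₄⟩ := h.exists_dist_trace_eq hη
  obtain ⟨δ₅, p₅, h₅⟩ := h.exists_dist_trace_eq hζ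
  obtain ⟨s, hs, s₁, s₂, s₃, s₄, s₅⟩ : ∃ s, 0 < s ∧ s ≤ δ₁ ∧ s ≤ δ₂ ∧ s ≤ δ₃ ∧ s ≤ δ₄ ∧ s ≤ δ₅ :=
    ⟨min δ₁ (min δ₂ (min δ₃ (min δ₄ δ₅))), by simp [*], by simp, by simp, by simp, by simp,
      by simp⟩
  have hs' : (0 : ℝ) < s := hs
  set θ₁ := angleAt p ξ η + ε
  set θ₂ := angleAt p η ζ + ε
  obtain ⟨r, u, v, hr, hrs, hu, hv, e₁, e₂, e₃⟩ :=
    exists_isosceles_division (θ₁ := θ₁) (θ₂ := θ₂) hs' (by positivity) (by positivity)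
      (by linarith)
  lift r to ℝ≥0 using hr.le
  have hr' : 0 < r := hr
  have hrs' : r ≤ s := hrs
  have hx := h.trace_ne hξ hs
  have hy := h.trace_ne hη hr'
  have hz := h.trace_ne hζ hs
  have dx := h₃ s s₃
  have dy := h₄ r (hrs'.trans s₄)
  have dz := h₅ s s₅
  have a₁ := h₁ s r hs s₁ hr' (hrs'.trans s₁)
  have a₂ := h₂ r s hr' (hrs'.trans s₂) hs s₂
  have a₃ := hsum.trans_le (h.angleAt_le_comparisonAngle hξ hζ hs hs)
  set x := trace p ξ s
  set y := trace p η r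
  set z := trace p ζ s
  have c₁ := Real.cos_le_cos_of_nonneg_of_le_pi (comparisonAngle_nonneg _ _ _)
    (by linarith) a₁.le
  have c₂ := Real.cos_le_cos_of_nonneg_of_le_pi (comparisonAngle_nonneg _ _ _)
    (by linarith) a₂.le
  have c₃ := Real.cos_lt_cos_of_nonneg_of_le_pi (by positivity)
    (comparisonAngle_le_pi _ _ _) a₃
  rw [cos_comparisonAngle hx hy] at c₁
  rw [cos_comparisonAngle hy hz] at c₂
  rw [cos_comparisonAngle hx hz] at c₃
  have d₁ := dist_sq_eq hx hy
  have d₂ := dist_sq_eq hy hz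
  have d₃ := dist_sq_eq hx hz
  rw [dx, dy] at d₁
  rw [dy, dz] at d₂
  rw [dx, dz] at d₃
  have hsr : (0 : ℝ) < 2 * s * r := by positivity
  have f₁ : dist x y ≤ u := by
    refine abs_le_of_sq_le_sq' ?_ hu |>.2
    linarith [mul_le_mul_of_nonneg_left c₁ hsr.le]
  have f₂ : dist y z ≤ v := by
    refine abs_le_of_sq_le_sq' ?_ hv |>.2
    linarith [mul_le_mul_of_nonneg_left c₂ hsr.le]
  have f₃ : dist x z ^ 2 ≤ (u + v) ^ 2 :=
    pow_le_pow_left₀ dist_nonneg ((dist_triangle x y z).trans (add_le_add f₁ f₂)) 2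
  linarith [mul_lt_mul_of_pos_left c₃ (show (0 : ℝ) < 2 * s ^ 2 by positivity)]

lemma IsCAT0.angleAt_map (h : IsCAT0 X) (g : X ≃ᵢ X) (p : X) (ξ η : Bordification X) :
    angleAt (g p) (ξ.map g) (η.map g) = angleAt p ξ η := by
  simp only [angleAt, h.trace_map, comparisonAngle, g.dist_eq]

lemma IsCAT0.angleAt_inside_trace (h : IsCAT0 X) (p : X) (ξ η : Bordification X) {r : ℝ≥0}
    (hr : 0 < r) : angleAt p ξ (.inside (trace p η r)) = angleAt p ξ η := by
  refine limsup_congr ?_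
  filter_upwards [nhdsGT_zero_le hr hr] with st hst
  rw [h.trace_trace, min_eq_left hst.2.2]

lemma IsCAT0.angleAt_inside_le (h : IsCAT0 X) {p x y : X} (hx : p ≠ x) (hy : p ≠ y) :
    angleAt p (.inside x) (.inside y) ≤ comparisonAngle p x y := by
  have := h.angleAt_le_comparisonAngle (p := p) (ξ := .inside x) (η := .inside y)
    (by simpa using hx) (by simpa using hy) (s := nndist p x) (t := nndist p y)
    (dist_pos.2 hx) (dist_pos.2 hy)
  rwa [h.trace_inside_of_le (by simp), h.trace_inside_of_le (by simp)] at this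

lemma IsCAT0.eventually_ne_of_coneTendsto (h : IsCAT0 X) {ι : Type*} {l : Filter ι}
    {z : ι → Bordification X} {ζ : Boundary X} (hz : ConeTendsto z l (.atInfinity ζ)) (p : X) :
    ∀ᶠ i in l, .inside p ≠ z i := by
  filter_upwards [(hz p 1).eventually_ne (h.trace_ne (p := p) (by simp) one_pos).symm] with i hi e
  exact hi (by rw [← e, h.trace_self])

/-- The angle is dominated by the comparison angle at radius `1`, which depends continuously on the
traces. -/
lemma IsCAT0.tendsto_angleAt (h : IsCAT0 X) {ι : Type*} {l : Filter ι}
    {z : ι → Bordification X} {ζ : Boundary X} (hz : ConeTendsto z l (.atInfinity ζ)) (p : X) :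
    Tendsto (fun i => angleAt p (z i) (.atInfinity ζ)) l (𝓝 0) := by
  have hy := h.trace_ne (p := p) (ξ := .atInfinity ζ) (by simp) one_pos
  have lim : Tendsto (fun i => comparisonAngle p (trace p (z i) 1) (trace p (.atInfinity ζ) 1)) l
      (𝓝 0) := by
    have hc : ContinuousAt (fun x => comparisonAngle p x (trace p (.atInfinity ζ) 1))
        (trace p (.atInfinity ζ) 1) := by
      unfold comparisonAngle
      refine Real.continuous_arccos.continuousAt.comp (ContinuousAt.div (by fun_prop)
        (by fun_prop) ?_)
      have := dist_pos.2 hy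
      positivity
    have := hc.tendsto.comp (hz p 1)
    rwa [comparisonAngle_self hy] at this
  refine tendsto_of_tendsto_of_tendsto_of_le_of_le' tendsto_const_nhds lim
    (Eventually.of_forall fun _ => angleAt_nonneg _ _ _) ?_
  filter_upwards [h.eventually_ne_of_coneTendsto hz p] with i hi
  exact h.angleAt_le_comparisonAngle hi (by simp) one_pos one_pos

lemma IsCAT0.coneTendsto_trace (h : IsCAT0 X) (p : X) (η : Bordification X) :
    ConeTendsto (fun t : ℝ≥0 => .inside (trace p η t)) atTop η := by
  refine h.coneTendsto_of p fun r => tendsto_const_nhds.congr' ?_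
  filter_upwards [eventually_ge_atTop r] with t ht
  rw [h.trace_trace, min_eq_left ht]

/-- Two angles of a triangle, possibly with an ideal vertex, sum up to at most `π`. -/
lemma IsCAT0.angleAt_add_le_pi (h : IsCAT0 X) {p q : X} {η : Bordification X} (hpq : p ≠ q)
    (hp : .inside p ≠ η) (hq : .inside q ≠ η) :
    angleAt p (.inside q) η + angleAt q (.inside p) η ≤ Real.pi := by
  cases η with
  | inside x =>
    have hp' : p ≠ x := by simpa using hp
    have hq' : q ≠ x := by simpa using hq
    exact (add_le_add (h.angleAt_inside_le hpq hp') (h.angleAt_inside_le hpq.symm hq')).trans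
      (comparisonAngle_add_le_pi hpq hp' hq')
  | atInfinity ξ =>
    -- Replace the ideal vertex by a point far out on the ray from `p`: the angle at `p` is
    -- unchanged, and the error at `q` tends to `0`.
    have hlim := (h.tendsto_angleAt (h.coneTendsto_trace p (.atInfinity ξ)) q).const_add Real.pi
    rw [add_zero] at hlim
    refine ge_of_tendsto hlim ?_
    filter_upwards [h.eventually_ne_of_coneTendsto (h.coneTendsto_trace p (.atInfinity ξ)) q,
      eventually_gt_atTop 0] with t ht ht0
    have ht' : q ≠ trace p (.atInfinity ξ) t := by simpa using ht
    have hpt := h.trace_ne hp ht0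
    have h1 := h.angleAt_triangle (p := q) (ξ := .inside p) (by simpa using hpq.symm) ht hq
    have h2 := comparisonAngle_add_le_pi hpq hpt ht'
    have h3 := h.angleAt_inside_le hpq hpt
    have h4 := h.angleAt_inside_le hpq.symm ht'
    rw [h.angleAt_inside_trace _ _ _ ht0] at h3
    linarith

/-! ### Limits in the bordification: uniqueness, compactness, stability. -/

lemma IsCAT0.trace_injective (h : IsCAT0 X) (p : X) : Function.Injective (trace p) := by
  have key : ∀ (x : X) (ξ : Boundary X), trace p (.inside x) ≠ trace p (.atInfinity ξ) := by
    intro x ξ e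
    have h1 := congrArg (dist p) (congrFun e (nndist p x + 1))
    rw [h.dist_trace_atInfinity, (h.trace_inside_spec p x _).1, min_eq_right (by simp)] at h1
    simp at h1
  intro ξ η e
  cases ξ with
  | inside x =>
    cases η with
    | inside y =>
      have h1 := congrFun e (max (nndist p x) (nndist p y))
      rw [h.trace_inside_of_le (by simp), h.trace_inside_of_le (by simp)] at h1
      rw [h1]
    | atInfinity η => exact (key _ _ e).elim
  | atInfinity ξ =>
    cases η with
    | inside y => exact (key _ _ e.symm).elim
    | atInfinity η =>
      obtain ⟨c, -, rfl, h2⟩ := h.exists_ray_trace p ξ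
      obtain ⟨c', -, rfl, h2'⟩ := h.exists_ray_trace p η
      have : c = c' := Subtype.ext (funext fun r => by rw [← h2, ← h2', e])
      rw [this]

lemma IsCAT0.coneTendsto_unique (h : IsCAT0 X) [Nonempty X] {ι : Type*} {l : Filter ι} [l.NeBot]
    {z : ι → Bordification X} {ζ ζ' : Bordification X} (hz : ConeTendsto z l ζ)
    (hz' : ConeTendsto z l ζ') : ζ = ζ' :=
  h.trace_injective (Classical.arbitrary X)
    (funext fun r => tendsto_nhds_unique (hz _ r) (hz' _ r))

lemma IsCAT0.coneTendsto_inside (h : IsCAT0 X) {ι : Type*} {l : Filter ι} {x : ι → X} {y : X}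
    (hx : Tendsto x l (𝓝 y)) : ConeTendsto (fun i => .inside (x i)) l (.inside y) := by
  intro p r
  rw [tendsto_iff_dist_tendsto_zero] at hx ⊢
  refine squeeze_zero (fun _ => dist_nonneg) (fun i => h.dist_trace_trace_le p (x i) y r) ?_
  simpa using hx.const_mul 2

/-- The bordification of a proper space is compact. -/
lemma IsCAT0.exists_coneTendsto (h : IsCAT0 X) [ProperSpace X] [hne : Nonempty X] {ι : Type*}
    (l : Ultrafilter ι) (z : ι → Bordification X) : ∃ ζ, ConeTendsto z l ζ := by
  obtain ⟨x₀⟩ := hne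
  have lim : ∀ r : ℝ≥0, ∃ y, Tendsto (fun i => trace x₀ (z i) r) l (𝓝 y) := by
    intro r
    have hm : (fun i => trace x₀ (z i) r) ⁻¹' Metric.closedBall x₀ r ∈ (l : Filter ι) :=
      Eventually.of_forall fun i => by
        change dist (trace x₀ (z i) r) x₀ ≤ r
        rw [dist_comm]
        exact h.dist_trace_le _ _ _
    obtain ⟨y, -, hy⟩ := (isCompact_closedBall x₀ (r : ℝ)).ultrafilter_le_nhds
      (l.map fun i => trace x₀ (z i) r) (le_principal_iff.2 hm)
    exact ⟨y, hy⟩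
  -- Either the points stay in a ball of `X`, and the limit is inside, or each trace eventually
  -- reaches its full radius, and the limiting traces form a ray.
  by_cases hb : ∃ R : ℝ≥0, ∀ᶠ i in l, ∃ x, z i = .inside x ∧ dist x₀ x ≤ R
  · obtain ⟨R, hR⟩ := hb
    obtain ⟨y, hy⟩ := lim R
    refine ⟨.inside y, fun p r => (h.coneTendsto_inside hy p r).congr' ?_⟩
    filter_upwards [hR] with i ⟨x, hx, hxR⟩
    rw [hx, h.trace_inside_of_le hxR]
  · have hfar : ∀ R : ℝ≥0, ∀ᶠ i in l, dist x₀ (trace x₀ (z i) R) = R := by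
      intro R
      have h1 : ∀ᶠ i in l, ¬ ∃ x, z i = .inside x ∧ dist x₀ x ≤ R :=
        Ultrafilter.eventually_not.2 fun h' => hb ⟨R, h'⟩
      filter_upwards [h1] with i hi
      cases hz : z i with
      | inside x =>
        rw [(h.trace_inside_spec x₀ x R).1]
        exact min_eq_left (not_le.1 fun h' => hi ⟨x, hz, h'⟩).le
      | atInfinity ξ => exact h.dist_trace_atInfinity x₀ ξ R
    choose f hf using lim
    have hd : ∀ r s, r ≤ s → dist (f r) (f s) = s - r := by
      intro r s hrs
      refine tendsto_nhds_unique ((hf r).dist (hf s)) (tendsto_const_nhds.congr' ?_)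
      filter_upwards [hfar r, hfar s] with i hr hs
      have := h.trace_between x₀ (z i) hrs
      linarith
    let c : GeodesicRay X := ⟨f, isometry_of_dist_eq_sub hd⟩
    have hc0 : c.1 0 = x₀ :=
      tendsto_nhds_unique (hf 0) (tendsto_const_nhds.congr fun i => (h.trace_zero _ _).symm)
    refine ⟨.atInfinity c.endpoint, h.coneTendsto_of x₀ fun r => ?_⟩
    have := h.trace_endpoint c r
    rw [hc0] at this
    rw [this]
    exact hf r

lemma IsCAT0.tendsto_dist_atTop (h : IsCAT0 X) {ι : Type*} {l : Filter ι} {x : ι → X}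
    {ξ : Boundary X} (hx : ConeTendsto (fun i => .inside (x i)) l (.atInfinity ξ)) (p : X) :
    Tendsto (fun i => dist p (x i)) l atTop := by
  rw [tendsto_atTop]
  intro b
  obtain ⟨R, hR⟩ : ∃ R : ℝ≥0, b ≤ R := ⟨⟨|b|, abs_nonneg b⟩, le_abs_self b⟩
  have h1 := (tendsto_const_nhds (x := p)).dist (hx p (R + 1))
  rw [h.dist_trace_atInfinity] at h1
  filter_upwards [h1.eventually_const_lt (show (R : ℝ) < (R + 1 : ℝ≥0) by push_cast; linarith)]
    with i hi
  rw [(h.trace_inside_spec p _ _).1] at hi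
  exact hR.trans (hi.le.trans (min_le_right _ _))

/-- A point at bounded distance from points converging to infinity has the same limit. -/
lemma IsCAT0.coneTendsto_of_dist_le (h : IsCAT0 X) {ι : Type*} {l : Filter ι} {x : ι → X}
    {z : ι → Bordification X} {ξ : Boundary X}
    (hx : ConeTendsto (fun i => .inside (x i)) l (.atInfinity ξ)) {K : ℝ}
    (hz : ∀ᶠ i in l, ∃ y, z i = .inside y ∧ dist (x i) y ≤ K) :
    ConeTendsto z l (.atInfinity ξ) := by
  intro p r
  refine (tendsto_iff_of_dist ?_).1 (hx p r)
  rw [Metric.tendsto_nhds]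
  intro ε hε
  filter_upwards [hz, (h.tendsto_dist_atTop hx p).eventually_ge_atTop
    (r + K + 1 + r ^ 2 * K ^ 2 / ε ^ 2)] with i ⟨y, hy, hxy⟩ hi
  have hr := r.coe_nonneg
  have hK : 0 ≤ K := dist_nonneg.trans hxy
  have hq : 0 ≤ r ^ 2 * K ^ 2 / ε ^ 2 := by positivity
  have t := dist_triangle p y (x i)
  rw [dist_comm y] at t
  rw [Real.dist_0_eq_abs, abs_of_nonneg dist_nonneg, hy]
  obtain ⟨x1, x2⟩ := h.trace_inside_spec p (x i) r
  obtain ⟨y1, y2⟩ := h.trace_inside_spec p y r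
  rw [min_eq_left (by linarith)] at x1 y1
  have key := h.chord_sq_mul_le x2 y2 (x1.trans y1.symm)
  rw [x1] at key
  have hB : r ^ 2 * K ^ 2 / ε ^ 2 < dist p y := by linarith
  rw [div_lt_iff₀ (by positivity)] at hB
  have hB0 : 0 < dist p y := by linarith
  have hA : 1 ≤ dist p (x i) := by linarith
  set d := dist (trace p (.inside (x i)) r) (trace p (.inside y) r)
  have e1 : (r : ℝ) ^ 2 * (dist (x i) y ^ 2 - (dist p (x i) - dist p y) ^ 2) ≤ r ^ 2 * K ^ 2 := by
    have := pow_le_pow_left₀ dist_nonneg hxy 2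
    gcongr
    linarith [sq_nonneg (dist p (x i) - dist p y)]
  have e2 : d ^ 2 * dist p y ≤ d ^ 2 * (dist p (x i) * dist p y) := by
    gcongr
    exact le_mul_of_one_le_left hB0.le hA
  refine lt_of_pow_lt_pow_left₀ 2 hε.le (lt_of_mul_lt_mul_right (a := dist p y) ?_ hB0.le)
  linarith

lemma IsCAT0.eventually_inside (h : IsCAT0 X) {ι : Type*} {l : Filter ι}
    {z : ι → Bordification X} {w : X} (hz : ConeTendsto z l (.inside w)) :
    ∀ᶠ i in l, ∃ x, z i = .inside x ∧ dist w x ≤ 1 := by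
  have h1 := (tendsto_const_nhds (x := w)).dist (hz w 1)
  rw [h.trace_self, dist_self] at h1
  filter_upwards [h1.eventually_lt_const one_pos] with i hi
  cases hzi : z i with
  | inside x =>
    rw [hzi, (h.trace_inside_spec w x 1).1] at hi
    refine ⟨x, rfl, ?_⟩
    rcases min_lt_iff.1 hi with h2 | h2
    · simp at h2
    · exact h2.le
  | atInfinity ξ =>
    rw [hzi, h.dist_trace_atInfinity] at hi
    simp at hi

/-! ### Dynamics of the sequence of isometries. -/

lemma IsCAT0.coneTendsto_orbit (h : IsCAT0 X) {ι : Type*} {l : Filter ι} {G : ι → X ≃ᵢ X} {x₀ : X}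
    {ξ : Boundary X} (hG : ConeTendsto (fun i => .inside (G i x₀)) l (.atInfinity ξ)) (q : X) :
    ConeTendsto (fun i => .inside (G i q)) l (.atInfinity ξ) :=
  h.coneTendsto_of_dist_le hG (K := dist x₀ q)
    (Eventually.of_forall fun i => ⟨_, rfl, ((G i).dist_eq _ _).le⟩)

lemma IsCAT0.angleAt_self (h : IsCAT0 X) (p : X) (ξ : Boundary X) :
    angleAt p (.atInfinity ξ) (.atInfinity ξ) = 0 := by
  refine le_antisymm ?_ (angleAt_nonneg _ _ _)
  have hξ : Bordification.inside p ≠ .atInfinity ξ := by simp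
  exact (h.angleAt_le_comparisonAngle hξ hξ one_pos one_pos).trans_eq
    (comparisonAngle_self (h.trace_ne hξ one_pos))

/-- If `η` is seen from `q` at an angle greater than `π / 2` from the repelling point, its image is
eventually seen from `p` at an angle of at most about `π / 2` from the attracting point. -/
lemma IsCAT0.eventually_angleAt_map_le (h : IsCAT0 X) {ι : Type*} {l : Filter ι} {G : ι → X ≃ᵢ X}
    {x₀ : X} {ξp ξm : Boundary X}
    (hp : ConeTendsto (fun i => .inside (G i x₀)) l (.atInfinity ξp))
    (hm : ConeTendsto (fun i => .inside ((G i).symm x₀)) l (.atInfinity ξm))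
    {η : ι → Bordification X} {q : X} (hq : ∀ᶠ i in l, .inside q ≠ η i)
    (hη : ∀ᶠ i in l, Real.pi / 2 < angleAt q (η i) (.atInfinity ξm)) (p : X) {ε : ℝ} (hε : 0 < ε) :
    ∀ᶠ i in l, angleAt p (.atInfinity ξp) ((η i).map (G i)) ≤ Real.pi / 2 + ε := by
  have hGq := h.coneTendsto_orbit hp q
  have hGp := h.coneTendsto_orbit (G := fun i => (G i).symm) hm p
  filter_upwards [hq, hη, h.eventually_ne_of_coneTendsto hGq p,
    h.eventually_ne_of_coneTendsto hGp q,
    (h.tendsto_angleAt hGq p).eventually_lt_const (half_pos hε),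
    -- The bound `π / 2` ensures that `η i` is not `(G i).symm p`, so that the angle at `p` makes
    -- sense.
    (h.tendsto_angleAt hGp q).eventually_lt_const (lt_min (half_pos hε) Real.pi_div_two_pos)]
    with i h1 h2 h3 h4 h5 h6
  have h6' := lt_min_iff.1 h6
  have h3' : p ≠ G i q := by simpa using h3
  have n1 : .inside p ≠ (η i).map (G i) := by
    intro e
    rw [Bordification.eq_of_map_eq_inside e.symm] at h2
    linarith
  have n2 : .inside (G i q) ≠ (η i).map (G i) := by
    intro e
    apply h1
    rw [Bordification.eq_of_map_eq_inside e.symm, (G i).symm_apply_apply]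
  have t1 := h.angleAt_triangle h1 h4 (ζ := .atInfinity ξm) (by simp)
  have t2 := h.angleAt_map (G i) q (.inside ((G i).symm p)) (η i)
  have e : Bordification.map (G i) (.inside ((G i).symm p)) = .inside p := by
    rw [Bordification.map, (G i).apply_symm_apply]
  rw [e] at t2
  have t3 := h.angleAt_add_le_pi h3' n1 n2
  have t4 := h.angleAt_triangle (ξ := .atInfinity ξp) (by simp) h3 n1
  rw [angleAt_comm p (.atInfinity ξp) (.inside (G i q))] at t4
  rw [angleAt_comm q (η i) (.inside _)] at t1
  linarith

/-- A limit `w ∈ X` would keep `η i` near `(G i).symm w`, forcing `η' = ξm` and an angle `0`. If `η'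
∈ X`, then `ζ = ξp`. Otherwise the angle estimate passes to the limit. -/
lemma IsCAT0.limit_mem_rightAngleBall (h : IsCAT0 X) {ι : Type*} {l : Filter ι} [l.NeBot]
    {G : ι → X ≃ᵢ X} {x₀ : X} {ξp ξm : Boundary X}
    (hp : ConeTendsto (fun i => .inside (G i x₀)) l (.atInfinity ξp))
    (hm : ConeTendsto (fun i => .inside ((G i).symm x₀)) l (.atInfinity ξm))
    {η : ι → Bordification X} {η' ζ : Bordification X} (hη : ConeTendsto η l η')
    (hζ : ConeTendsto (fun i => (η i).map (G i)) l ζ)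
    (hangle : ∀ ξ, η' = .atInfinity ξ → Real.pi / 2 < angle η' (.atInfinity ξm)) :
    ζ ∈ rightAngleBall ξp := by
  have : Nonempty X := ⟨x₀⟩
  cases ζ with
  | inside w =>
    have hηm : ConeTendsto η l (.atInfinity ξm) := by
      refine h.coneTendsto_of_dist_le
        (h.coneTendsto_orbit (G := fun i => (G i).symm) hm w) (K := 1) ?_
      filter_upwards [h.eventually_inside hζ] with i ⟨x, hx, hwx⟩
      exact ⟨_, Bordification.eq_of_map_eq_inside hx, by rwa [(G i).symm.dist_eq]⟩
    have e := h.coneTendsto_unique hη hηm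
    have h1 := hangle _ e
    obtain ⟨q, -, -, hq⟩ := exists_lt_angleAt Real.pi_div_two_pos.le h1
    rw [e, h.angleAt_self] at hq
    linarith [Real.pi_pos]
  | atInfinity ζ =>
    refine ⟨ζ, ?_, rfl⟩
    have : Nonempty {p : X // Bordification.inside p ≠ .atInfinity ξp ∧
      Bordification.inside p ≠ .atInfinity ζ} := ⟨⟨x₀, by simp, by simp⟩⟩
    change angle _ _ ≤ _
    refine ciSup_le fun ⟨p, _, _⟩ => ?_
    change angleAt p (.atInfinity ξp) (.atInfinity ζ) ≤ _
    cases η' with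
    | inside y =>
      have hζp : ConeTendsto (fun i => (η i).map (G i)) l (.atInfinity ξp) := by
        refine h.coneTendsto_of_dist_le (h.coneTendsto_orbit hp y) (K := 1) ?_
        filter_upwards [h.eventually_inside hη] with i ⟨x, hx, hyx⟩
        exact ⟨G i x, by rw [hx]; rfl, by rwa [(G i).dist_eq]⟩
      rw [h.coneTendsto_unique hζ hζp, h.angleAt_self]
      exact Real.pi_div_two_pos.le
    | atInfinity η' =>
      obtain ⟨q, -, -, hq⟩ := exists_lt_angleAt Real.pi_div_two_pos.le (hangle _ rfl)
      have n1 := h.eventually_ne_of_coneTendsto hη q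
      have n2 := h.eventually_ne_of_coneTendsto hζ p
      -- At a fixed `q`, the strict inequality for `η'` persists for the nearby `η i`.
      have l1 : ∀ᶠ i in l, Real.pi / 2 < angleAt q (η i) (.atInfinity ξm) := by
        filter_upwards [n1, (h.tendsto_angleAt hη q).eventually_lt_const (sub_pos.2 hq)] with i h1 h2
        have := h.angleAt_triangle (ξ := .atInfinity η') (ζ := .atInfinity ξm) (by simp) h1
          (by simp)
        rw [angleAt_comm q (.atInfinity η') (η i)] at this
        linarith
      refine le_of_forall_pos_le_add fun ε hε => ?_
      obtain ⟨i, h1, h2, h3⟩ := ((h.eventually_angleAt_map_le hp hm n1 l1 p (half_pos hε)).and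
        (n2.and ((h.tendsto_angleAt hζ p).eventually_lt_const (half_pos hε)))).exists
      have := h.angleAt_triangle (ξ := .atInfinity ξp) (ζ := .atInfinity ζ) (by simp) h2 (by simp)
      linarith

/-! ### The star, and uniform convergence by compactness. -/

lemma IsCAT0.angleAt_eq_pi_of_between (h : IsCAT0 X) {q u v : X} (hu : q ≠ u) (hv : q ≠ v)
    (huv : dist u q + dist q v = dist u v) : angleAt q (.inside u) (.inside v) = Real.pi := by
  refine le_antisymm (angleAt_le_pi _ _ _) ?_
  refine le_limsup_of_frequently_le (Eventually.frequently ?_)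
    (isBoundedUnder_comparisonAngle _ _ _ _)
  filter_upwards [nhdsGT_zero_le one_pos one_pos] with st hst
  have u0 := dist_pos.2 (h.trace_ne (p := q) (ξ := .inside u) (by simpa using hu) hst.1.1)
  have v0 := dist_pos.2 (h.trace_ne (p := q) (ξ := .inside v) (by simpa using hv) hst.2.1)
  obtain ⟨-, u2⟩ := h.trace_inside_spec q u st.1
  obtain ⟨-, v2⟩ := h.trace_inside_spec q v st.2
  set u' := trace q (.inside u) st.1
  set v' := trace q (.inside v) st.2
  have t1 := dist_triangle4 u u' v' v
  have t2 := dist_triangle u' q v'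
  rw [dist_comm u q] at huv
  rw [dist_comm u u'] at t1
  rw [dist_comm u' q] at t2
  have e : dist u' v' = dist q u' + dist q v' := by linarith
  rw [comparisonAngle, Real.arccos_eq_pi.2]
  rw [div_le_iff₀ (by positivity), e]
  linarith

/-- Points at angular distance at most `π / 2` from a boundary point belong to its star. -/
lemma IsCAT0.mem_star_of_angle_le (h : IsCAT0 X) (x₀ : X) {η ξ : Boundary X}
    (hηξ : angle (.atInfinity η) (.atInfinity ξ) ≤ Real.pi / 2) :
    .atInfinity η ∈ star x₀ ξ := by
  let := coneTopology x₀
  refine subset_closure (mem_iUnion₂.2 ⟨0, le_rfl, mem_iInter₂.2 fun V hV => mem_iInter.2 fun hξV =>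
    ?_⟩)
  have hev := (h.coneTendsto_iff x₀).1 (h.coneTendsto_trace x₀ (.atInfinity ξ)) |>.eventually
    (hV.mem_nhds hξV)
  obtain ⟨s, hsV, hs⟩ := (hev.and (eventually_gt_atTop 0)).exists
  -- From `q ∈ V`, on the ray from `x₀` to `ξ`, the directions of `x₀` and `ξ` are opposite, so `η`
  -- makes an angle at least `π / 2` with `x₀`. Every point of the ray from `q` to `η` is then no
  -- farther from `q` than from `x₀`, so `C = 0` suffices.
  set q := trace x₀ (.atInfinity ξ) s with hq
  refine mem_closure_of_tendsto ((h.coneTendsto_iff x₀).1 (h.coneTendsto_trace q (.atInfinity η))) ?_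
  filter_upwards [eventually_gt_atTop 0] with r hr
  have hqx : q ≠ x₀ := (h.trace_ne (by simp) hs).symm
  have hqz : q ≠ trace q (.atInfinity η) r := h.trace_ne (by simp) hr
  have hpi : angleAt q (.inside x₀) (.atInfinity ξ) = Real.pi := by
    obtain ⟨c, h0, h1, h2⟩ := h.exists_ray_trace x₀ ξ
    obtain ⟨b, hb⟩ : ∃ b : GeodesicRay X, ∀ t, b.1 t = c.1 (s + t) :=
      ⟨⟨fun t => c.1 (s + t), isometry_of_dist_eq_sub fun t t' htt => by
        rw [c.dist_eq (by gcongr)]; push_cast; ring⟩, fun _ => rfl⟩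
    have hb0 : b.1 0 = q := by rw [hb, add_zero, hq, h2]
    have hbe : b.endpoint = ξ := by
      rw [← h1]
      refine Quotient.sound ⟨s, fun t => ?_⟩
      rw [hb, dist_comm, c.dist_eq le_add_self]; push_cast; linarith
    have ht := h.trace_endpoint b 1
    rw [hb0, hbe, hb] at ht
    rw [← h.angleAt_inside_trace q _ _ one_pos]
    refine h.angleAt_eq_pi_of_between hqx (h.trace_ne (by simp) one_pos) ?_
    rw [ht, hq, h2, ← h0, c.between le_self_add]
  have t1 := h.angleAt_triangle (p := q) (ξ := .inside x₀) (η := .atInfinity η)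
    (ζ := .atInfinity ξ) (by simpa using hqx) (by simp) (by simp)
  have t2 := (angleAt_le_angle (p := q) (ξ := .atInfinity η) (η := .atInfinity ξ) (by simp)
    (by simp)).trans hηξ
  have t3 := h.angleAt_inside_le hqx hqz
  rw [h.angleAt_inside_trace _ _ _ hr, comparisonAngle_eq] at t3
  have t4 : compCos q x₀ (trace q (.atInfinity η) r) ≤ 0 :=
    not_lt.1 fun hlt => (Real.arccos_lt_pi_div_two.2 hlt).not_ge (by linarith)
  have t5 := dist_sq_eq hqx hqz
  set z := trace q (.atInfinity η) r
  refine ⟨z, ⟨⟨q, hsV⟩, ?_⟩, rfl⟩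
  have t6 := mul_nonneg (mul_nonneg (dist_nonneg (x := q) (y := x₀)) (dist_nonneg (x := q) (y := z)))
    (neg_nonneg.2 t4)
  have t7 : dist q z ≤ dist x₀ z :=
    (abs_le_of_sq_le_sq' (by linarith [sq_nonneg (dist q x₀)]) dist_nonneg).2
  rw [add_zero, dist_comm z x₀]
  refine le_trans ?_ t7
  rw [dist_comm q z]
  exact Metric.infDist_le_dist_of_mem hsV

/-- Were it false, an ultrafilter on the bad indices would give limits of `η n` and of its images;
the second lies in `U`, although the images avoid this open set. -/
lemma IsCAT0.eventually_map_mem (h : IsCAT0 X) [ProperSpace X] {x₀ : X} {g : ℕ → X ≃ᵢ X}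
    {ξp ξm : Boundary X}
    (hp : ConeTendsto (fun n => .inside (g n x₀)) atTop (.atInfinity ξp))
    (hm : ConeTendsto (fun n => .inside ((g n).symm x₀)) atTop (.atInfinity ξm))
    {A U : Set (Bordification X)} (hU : IsOpen[coneTopology x₀] U) (hBU : rightAngleBall ξp ⊆ U)
    (hA : ∀ ξ, .atInfinity ξ ∈ @closure _ (coneTopology x₀) A →
      Real.pi / 2 < angle (.atInfinity ξ) (.atInfinity ξm)) :
    ∀ᶠ n in atTop, ∀ η ∈ A, η.map (g n) ∈ U := by
  let := coneTopology x₀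
  have : Nonempty X := ⟨x₀⟩
  by_contra hcon
  have hfreq : ∃ᶠ n in atTop, n ∈ {n | ∃ η ∈ A, η.map (g n) ∉ U} := by
    refine (not_eventually.1 hcon).mono fun n hn => ?_
    push Not at hn
    exact hn
  have := frequently_mem_iff_neBot.1 hfreq
  have hch : ∀ n, ∃ η : Bordification X, n ∈ {n | ∃ η ∈ A, η.map (g n) ∉ U} →
      η ∈ A ∧ η.map (g n) ∉ U := fun n => by
    by_cases hn : n ∈ {n | ∃ η ∈ A, η.map (g n) ∉ U}
    · exact ⟨hn.choose, fun _ => hn.choose_spec⟩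
    · exact ⟨.inside x₀, fun h' => (hn h').elim⟩
  choose η hη using hch
  set l := Ultrafilter.of (atTop ⊓ 𝓟 {n | ∃ η ∈ A, η.map (g n) ∉ U})
  have hl := Ultrafilter.of_le (atTop ⊓ 𝓟 {n | ∃ η ∈ A, η.map (g n) ∉ U})
  have hlT : (l : Filter ℕ) ≤ atTop := hl.trans inf_le_left
  have hlA : ∀ᶠ n in (l : Filter ℕ), η n ∈ A ∧ (η n).map (g n) ∉ U :=
    mem_of_superset (le_principal_iff.1 (hl.trans inf_le_right)) hη
  obtain ⟨η', hη'⟩ := h.exists_coneTendsto l η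
  obtain ⟨ζ, hζ⟩ := h.exists_coneTendsto l fun n => (η n).map (g n)
  have hmem := h.limit_mem_rightAngleBall (fun p r => (hp p r).mono_left hlT)
    (fun p r => (hm p r).mono_left hlT) hη' hζ (by
      rintro ξ rfl
      exact hA ξ (mem_closure_of_tendsto ((h.coneTendsto_iff x₀).1 hη') (hlA.mono fun _ => And.left)))
  have := ((h.coneTendsto_iff x₀).1 hζ).eventually (hU.mem_nhds (hBU hmem))
  obtain ⟨n, h1, h2⟩ := (this.and hlA).exists
  exact h2.2 h1

end CatZero

theorem theorem6p5 {X : Type*} [MetricSpace X] [CompleteSpace X] (hX : CatZero.IsCAT0 X)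
    (x₀ : X) (g : ℕ → X ≃ᵢ X) (ξp ξm : CatZero.Boundary X)
    (hp : Tendsto (fun n => CatZero.Bordification.inside (g n x₀)) atTop
      (@nhds _ (CatZero.coneTopology x₀) (.atInfinity ξp)))
    (hm : Tendsto (fun n => CatZero.Bordification.inside ((g n).symm x₀)) atTop
      (@nhds _ (CatZero.coneTopology x₀) (.atInfinity ξm))) :
    -- the convergence in a general complete space
    (∀ η : CatZero.Bordification X, Real.pi / 2 < CatZero.angle η (.atInfinity ξm) →
      ∀ p : X, limsup (fun n => CatZero.angleAt p (.atInfinity ξp) (η.map (g n))) atTop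
        ≤ Real.pi / 2) ∧
    -- the convergence in a proper space
    (ProperSpace X →
      ∀ η : CatZero.Bordification X, Real.pi / 2 < CatZero.angle η (.atInfinity ξm) →
        ∀ U : Set (CatZero.Bordification X), IsOpen[CatZero.coneTopology x₀] U →
          CatZero.rightAngleBall ξp ⊆ U → ∀ᶠ n in atTop, η.map (g n) ∈ U) ∧
    -- its uniformity outside neighbourhoods of the star
    (ProperSpace X →
      ∀ W : Set (CatZero.Bordification X), IsOpen[CatZero.coneTopology x₀] W →
        CatZero.star x₀ ξm ⊆ W →
        ∀ U : Set (CatZero.Bordification X), IsOpen[CatZero.coneTopology x₀] U →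
          CatZero.rightAngleBall ξp ⊆ U → ∀ᶠ n in atTop, ∀ η ∉ W, η.map (g n) ∈ U) := by
  have : Nonempty X := ⟨x₀⟩
  have hp' := (hX.coneTendsto_iff x₀).2 hp
  have hm' := (hX.coneTendsto_iff x₀).2 hm
  refine ⟨fun η hη p => ?_, fun hprop η hη U hU hBU => ?_, fun hprop W hW hS U hU hBU => ?_⟩
  · cases η with
    | inside y =>
      -- Every orbit of a point of `X` tends to `ξp`.
      have h1 := hX.tendsto_angleAt (hX.coneTendsto_orbit hp' y) p
      simp only [CatZero.angleAt_comm p _ (.atInfinity ξp)] at h1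
      exact h1.limsup_eq.trans_le Real.pi_div_two_pos.le
    | atInfinity η =>
      obtain ⟨q, hq1, -, hq⟩ := CatZero.exists_lt_angleAt Real.pi_div_two_pos.le hη
      refine le_of_forall_pos_le_add fun ε hε => ?_
      exact limsup_le_of_le (isBoundedUnder_of ⟨0, fun _ => CatZero.angleAt_nonneg _ _ _⟩ :
          IsBoundedUnder (· ≥ ·) atTop _).isCoboundedUnder_le
        (hX.eventually_angleAt_map_le hp' hm' (Eventually.of_forall fun _ => hq1)
          (Eventually.of_forall fun _ => hq) p hε)
  -- Uniqueness of limits shows that the closure of `{η}` adds no ideal point.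
  · refine (hX.eventually_map_mem hp' hm' (A := {η}) hU hBU fun ξ hξ => ?_).mono
      fun n hn => hn η rfl
    let := CatZero.coneTopology x₀
    obtain ⟨F, hF, hFη⟩ := mem_closure_iff_ultrafilter.1 hξ
    have h1 : CatZero.ConeTendsto id (F : Filter (CatZero.Bordification X)) (.atInfinity ξ) :=
      (hX.coneTendsto_iff x₀).2 hFη
    have h2 : CatZero.ConeTendsto id (F : Filter (CatZero.Bordification X)) η := fun p r =>
      tendsto_const_nhds.congr' (Filter.mem_of_superset hF fun ζ hζ => by
        rw [mem_singleton_iff.1 hζ]; rfl)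
    rwa [hX.coneTendsto_unique h1 h2]
  · refine (hX.eventually_map_mem hp' hm' (A := Wᶜ) hU hBU fun ξ hξ => ?_).mono
      fun n hn η hη => hn η hη
    let := CatZero.coneTopology x₀
    rw [hW.isClosed_compl.closure_eq] at hξ
    by_contra! hle
    exact hξ (hS (hX.mem_star_of_angle_le x₀ hle))
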